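/- Let $\mathcal I$ be a finite set of $I$ cells and let $\mathbf A$ be a design matrix with columns indexed by $\mathcal I$: a $0$-$1$ matrix of full row rank with at least one $1$ in every column (the row space of $\mathbf A$ may or may not contain the vector of ones, i.e. an overall effect may or may not be present). The relational model for probabilities is $$RM_{\boldsymbol p}(\mathbf A)=\Big\{\boldsymbol p\in\mathbb R^{\mathcal I}_{>0}:\ \sum_{i}p_i=1,\ \log\boldsymbol p=\mathbf A'\boldsymbol\theta\ \text{for some }\boldsymbol\theta\Big\}.$$ Let $\boldsymbol p_0\in RM_{\boldsymbol p}(\mathbf A)$ and, for every $N$, let $\boldsymbol Y=\boldsymbol Y_N\sim Mult(N,\boldsymbol p_0)$. Given the observed counts $\boldsymbol Y$, an MLE $\hat{\boldsymbol p}$ is a maximizer of the multinomial likelihood over $RM_{\boldsymbol p}(\mathbf A)$; let $\mathscr E$ be the set of count vectors for which it exists. The augmented MLE $\tilde{\boldsymbol p}$ equals $\hat{\boldsymbol p}$ if $\boldsymbol Y\in\mathscr E$ and the uniform vector $(1/I)\boldsymbol 1$ otherwise. For $\boldsymbol u\ge\boldsymbol 0$, $\boldsymbol v>\boldsymbol 0$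 put $$X^2(\boldsymbol u,\boldsymbol v)=\sum_i\frac{(u_i-v_i)^2}{v_i},\qquad B(\boldsymbol u,\boldsymbol v)=2\sum_i\Big\{u_i\log\frac{u_i}{v_i}-(u_i-v_i)\Big\},\qquad 0\log 0=0 .$$ Let $K=\dim\operatorname{Ker}(\mathbf A)$, and let $\chi^2_K$ be the law of the sum of squares of $K$ independent standard normal variables (the point mass at $0$ if $K=0$). Then $\mathbb P(\boldsymbol Y\in\mathscr E)>0$ for all sufficiently large $N$, and, as $N\to\infty$, each of the four laws $$\mathcal L\big(X^2(\boldsymbol Y,N\hat{\boldsymbol p})\mid\boldsymbol Y\in\mathscr E\big),\quad \mathcal L\big(B(\boldsymbol Y,N\hat{\boldsymbol p})\mid\boldsymbol Y\in\mathscr E\big),\quad \mathcal L\big(X^2(\boldsymbol Y,N\tilde{\boldsymbol p})\big),\quad \mathcal L\big(B(\boldsymbol Y,N\tilde{\boldsymbol p})\big)$$ converges weakly to $\chi^2_K$. -/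

import Mathlib

open MeasureTheory ProbabilityTheory Filter Topology

namespace RelationalModel

/-- `A` is a design matrix: a 0-1 matrix of full row rank with at least one `1` in every column.
Rows (indexed by `κ`) are the effects, columns (indexed by `ι`) are the cells. -/
structure IsDesignMatrix {κ ι : Type*} [Fintype ι] (A : Matrix κ ι ℝ) : Prop where
  zero_or_one : ∀ j i, A j i = 0 ∨ A j i = 1
  full_row_rank : LinearIndependent ℝ A.row
  one_in_column : ∀ i, ∃ j, A j i = 1

/-- The relational model for probabilities with design matrix `A`: all strictly positive
probability vectors `p` with `log p = A' θ` for some parameter vector `θ`. -/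
def modelProb {κ ι : Type*} [Fintype κ] [Fintype ι] (A : Matrix κ ι ℝ) : Set (ι → ℝ) :=
  {p | (∀ i, 0 < p i) ∧ ∑ i, p i = 1 ∧
    ∃ θ : κ → ℝ, (fun i => Real.log (p i)) = A.transpose.mulVec θ}

/-- The multinomial probability of the vector of counts `y` (with sample size `∑ i, y i`) under the
vector of cell probabilities `p`. As a function of `p` this is the likelihood given `y`. -/
noncomputable def multinomialProb {ι : Type*} [Fintype ι] (p : ι → ℝ) (y : ι → ℕ) : ℝ :=
  (Nat.multinomial Finset.univ y : ℝ) * ∏ i, p i ^ y i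

/-- The multinomial distribution `Mult(N, p)`, carried by the count vectors with total `N`. -/
noncomputable def multinomial {ι : Type*} [Fintype ι] [DecidableEq ι] (N : ℕ) (p : ι → ℝ) :
    Measure (ι → ℕ) :=
  ∑ y ∈ Finset.piAntidiag Finset.univ N,
    ENNReal.ofReal (multinomialProb p y) • Measure.dirac y

theorem isProbabilityMeasure_multinomial {ι : Type*} [Fintype ι] [DecidableEq ι] (N : ℕ)
    (p : ι → ℝ) (hp : ∀ i, 0 ≤ p i) (hsum : ∑ i, p i = 1) :
    IsProbabilityMeasure (multinomial N p) := by
  constructor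
  have h : ∀ y ∈ Finset.piAntidiag (Finset.univ : Finset ι) N, 0 ≤ multinomialProb p y := by
    intro y _
    exact mul_nonneg (Nat.cast_nonneg _) (Finset.prod_nonneg fun i _ => pow_nonneg (hp i) _)
  simp only [multinomial, Measure.finsetSum_apply, Measure.smul_apply, smul_eq_mul,
    measure_univ, mul_one]
  rw [← ENNReal.ofReal_sum_of_nonneg h]
  simp only [multinomialProb]
  rw [← Finset.sum_pow_eq_sum_piAntidiag, hsum]
  simp

/-- `p` is a maximum likelihood estimate under the model with design matrix `A`, given the
multinomial data `y`: it lies in the model and maximizes the likelihood over the model. -/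
def IsMLE {κ ι : Type*} [Fintype κ] [Fintype ι] (A : Matrix κ ι ℝ) (y : ι → ℕ) (p : ι → ℝ) :
    Prop :=
  p ∈ modelProb A ∧ IsMaxOn (fun q => multinomialProb q y) (modelProb A) p

/-- The set of count vectors for which the MLE under the model exists. -/
def mleExists {κ ι : Type*} [Fintype κ] [Fintype ι] (A : Matrix κ ι ℝ) : Set (ι → ℕ) :=
  {y | ∃ p, IsMLE A y p}

open Classical in
/-- The augmented MLE: the MLE `phat y` if it exists, and the uniform vector otherwise. -/
noncomputable def augmentedMLE {κ ι : Type*} [Fintype κ] [Fintype ι] (A : Matrix κ ι ℝ)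
    (phat : (ι → ℕ) → ι → ℝ) (y : ι → ℕ) : ι → ℝ :=
  if y ∈ mleExists A then phat y else fun _ => 1 / (Fintype.card ι : ℝ)

/-- The Pearson statistic. -/
noncomputable def pearson {ι : Type*} [Fintype ι] (u v : ι → ℝ) : ℝ :=
  ∑ i, (u i - v i) ^ 2 / v i

/-- The Bregman statistic; the convention `0 log 0 = 0` holds since `0 * x = 0`. -/
noncomputable def bregman {ι : Type*} [Fintype ι] (u v : ι → ℝ) : ℝ :=
  2 * ∑ i, (u i * Real.log (u i / v i) - (u i - v i))

/-- The chi-squared distribution with `K` degrees of freedom: the law of the sum of the squares of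
`K` independent standard normal variables (the point mass at `0` if `K = 0`). -/
noncomputable def chiSquared (K : ℕ) : Measure ℝ :=
  (Measure.pi fun _ : Fin K => gaussianReal 0 1).map fun x => ∑ k, x k ^ 2

instance isProbabilityMeasure_chiSquared (K : ℕ) : IsProbabilityMeasure (chiSquared K) :=
  Measure.isProbabilityMeasure_map
    (Measurable.aemeasurable (Finset.measurable_sum _ fun k _ => (measurable_pi_apply k).pow_const 2))

/-- A finite measure, bundled. -/
def bundle {Ω : Type*} [MeasurableSpace Ω] (μ : Measure Ω) [h : IsFiniteMeasure μ] :
    FiniteMeasure Ω :=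
  ⟨μ, h⟩

/-- The laws of the random variables `Z N`, under `μ N`, converge weakly to `ν`. The measures `μ N`
are finite measures, rather than probability measures, only because a conditional measure is by
convention `0` where the conditioning event is null. -/
def ConvergesInLaw {Ω : ℕ → Type*} [∀ N, MeasurableSpace (Ω N)] (μ : ∀ N, Measure (Ω N))
    [∀ N, IsFiniteMeasure (μ N)] (Z : ∀ N, Ω N → ℝ) (ν : Measure ℝ) [IsFiniteMeasure ν] : Prop :=
  Tendsto (fun N => (bundle (μ N)).map (Z N)) atTop (𝓝 (bundle ν))

end RelationalModel

namespace RelationalModel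

open scoped BoundedContinuousFunction

/-! Let `z = (Y - N p₀) / √(N p₀)`, coordinatewise. Characteristic functions show that `z` is
asymptotically centred Gaussian with covariance the identity minus the projection onto the unit
vector `√p₀`. On a subspace orthogonal to `√p₀` that defect is invisible, so the projection of `z`
is asymptotically standard Gaussian and its squared length is asymptotically chi-squared
(`tendsto_integral_norm_sq_projection`). The relevant subspace is the orthogonal complement of
`tangentSpan`; it has dimension `K` with or without an overall effect
(`finrank_orthogonal_tangentSpan`).

The rest is deterministic, and uniform over count vectors of total `N` with `‖z‖ ≤ M` as `N → ∞`.
All counts become positive, so an MLE exists by compactness (`mem_mleExists_of_pos`). Comparing its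
likelihood with that of `p₀` through the Kullback-Leibler divergence gives `log p̂ - log p₀ =
O(1/√N)` (`exists_abs_log_sub_log_le`). Hence the fitted displacement `√N (p̂ - p₀) / √p₀` lies in
`tangentSpan` up to `o(1)`, while the likelihood equations make the residual `(Y - N p̂) / √(N p₀)`
asymptotically orthogonal to that space. So the residual has asymptotically the same squared length
as the projection of `z` (`tendsto_norm_sq_residual_sub`). The Pearson statistic is this squared
length with weights `p₀ / p̂ → 1`, and the Bregman statistic agrees with it to second order.

Finally, `z` is tight, so what happens outside large balls is negligible: the MLE exists with
probability tending to one, and neither conditioning nor augmentation affects the limit. -/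

/-! ### Slutsky's theorem and conditioning on events of probability tending to one. -/

theorem tendsto_integral_of_tendsto_measure_sub {Ω : ℕ → Type*} [∀ N, MeasurableSpace (Ω N)]
    (P : ∀ N, Measure (Ω N)) [∀ N, IsProbabilityMeasure (P N)] {X Z : ∀ N, Ω N → ℝ}
    (hX : ∀ N, Measurable (X N)) (hZ : ∀ N, Measurable (Z N)) (ν : Measure ℝ)
    [IsProbabilityMeasure ν]
    (h : ∀ f : ℝ →ᵇ ℝ, Tendsto (fun N => ∫ ω, f (X N ω) ∂P N) atTop (𝓝 (∫ x, f x ∂ν)))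
    (hXZ : ∀ ε > 0, Tendsto (fun N => P N {ω | ε ≤ |Z N ω - X N ω|}) atTop (𝓝 0))
    (f : ℝ →ᵇ ℝ) : Tendsto (fun N => ∫ ω, f (Z N ω) ∂P N) atTop (𝓝 (∫ x, f x ∂ν)) := by
  -- Convergence in measure needs one common space. The infinite product provides it, and since each
  -- statement involves only one `N` at a time, the coupling is irrelevant.
  have hev N : MeasurePreserving (fun ω : ∀ n, Ω n => ω N) (Measure.infinitePi P) (P N) :=
    measurePreserving_eval_infinitePi P N
  have hXm N : Measurable (fun ω : ∀ n, Ω n => X N (ω N)) := (hX N).comp (measurable_pi_apply N)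
  have hZm N : Measurable (fun ω : ∀ n, Ω n => Z N (ω N)) := (hZ N).comp (measurable_pi_apply N)
  have h1 : TendstoInDistribution (fun N (ω : ∀ n, Ω n) => X N (ω N)) atTop (id : ℝ → ℝ)
      (fun _ => Measure.infinitePi P) ν := by
    refine ⟨fun N => (hXm N).aemeasurable, measurable_id.aemeasurable, ?_⟩
    refine ProbabilityMeasure.tendsto_iff_forall_integral_tendsto.mpr fun g => ?_
    simp only [ProbabilityMeasure.coe_mk, Measure.map_id]
    refine (h g).congr fun N => ?_
    rw [integral_map (hXm N).aemeasurable (by fun_prop), ← (hev N).map_eq,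
      integral_map (hev N).measurable.aemeasurable]
    exact (g.continuous.measurable.comp (hX N)).aestronglyMeasurable
  have h2 : TendstoInMeasure (Measure.infinitePi P)
      ((fun N (ω : ∀ n, Ω n) => Z N (ω N)) - (fun N (ω : ∀ n, Ω n) => X N (ω N))) atTop 0 := by
    rw [tendstoInMeasure_iff_norm]
    intro ε hε
    refine (hXZ ε hε).congr fun N => ?_
    have hm : MeasurableSet {ω | ε ≤ |Z N ω - X N ω|} :=
      measurableSet_le measurable_const ((hZ N).sub (hX N)).abs
    rw [← (hev N).measure_preimage hm.nullMeasurableSet]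
    simp [Set.preimage]
  have h3 := (tendstoInDistribution_of_tendstoInMeasure_sub _ _ h1 h2
    (fun N => (hZm N).aemeasurable)).tendsto
  have h4 := ProbabilityMeasure.tendsto_iff_forall_integral_tendsto.mp h3 f
  simp only [ProbabilityMeasure.coe_mk, Measure.map_id] at h4
  refine h4.congr fun N => ?_
  rw [integral_map (hZm N).aemeasurable (by fun_prop), ← (hev N).map_eq,
    integral_map (hev N).measurable.aemeasurable]
  exact (f.continuous.measurable.comp (hZ N)).aestronglyMeasurable

/-- A bounded integrand contributes `o(1)` over the complement of `S N`, and the normalizing factor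
`1 / P N (S N)` tends to one. -/
theorem tendsto_integral_cond {Ω : ℕ → Type*} [∀ N, MeasurableSpace (Ω N)]
    (P : ∀ N, Measure (Ω N)) [∀ N, IsProbabilityMeasure (P N)] {g : ∀ N, Ω N → ℝ} {C c : ℝ}
    (hg : ∀ N, Measurable (g N)) (hC : ∀ N ω, |g N ω| ≤ C) {S : ∀ N, Set (Ω N)}
    (hS : ∀ N, MeasurableSet (S N)) (hPS : Tendsto (fun N => P N (S N)ᶜ) atTop (𝓝 0))
    (h : Tendsto (fun N => ∫ ω, g N ω ∂P N) atTop (𝓝 c)) :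
    Tendsto (fun N => ∫ ω, g N ω ∂((P N)[|S N])) atTop (𝓝 c) := by
  have hreal : Tendsto (fun N => (P N).real (S N)ᶜ) atTop (𝓝 0) := by
    exact (ENNReal.tendsto_toReal ENNReal.zero_ne_top).comp hPS
  have hint N : Integrable (g N) (P N) :=
    Integrable.of_bound (hg N).aestronglyMeasurable C (ae_of_all _ (hC N))
  have hcompl : Tendsto (fun N => ∫ ω in (S N)ᶜ, g N ω ∂P N) atTop (𝓝 0) := by
    refine squeeze_zero_norm (fun N => ?_) (by simpa using hreal.const_mul C)
    exact norm_setIntegral_le_of_norm_le_const (measure_lt_top _ _) (fun ω _ => hC N ω)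
  have hin : Tendsto (fun N => ∫ ω in S N, g N ω ∂P N) atTop (𝓝 c) := by
    have := h.sub hcompl
    rw [sub_zero] at this
    refine this.congr fun N => ?_
    rw [← integral_add_compl (hS N) (hint N)]; ring
  have hmass : Tendsto (fun N => (P N).real (S N)) atTop (𝓝 1) := by
    have := hreal.const_sub 1
    rw [sub_zero] at this
    refine this.congr fun N => ?_
    rw [probReal_compl_eq_one_sub (hS N)]; ring
  have := (hmass.inv₀ one_ne_zero).mul hin
  rw [inv_one, one_mul] at this
  refine this.congr fun N => ?_
  rw [ProbabilityTheory.cond, integral_smul_measure, ENNReal.toReal_inv, smul_eq_mul,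
    measureReal_def]

theorem convergesInLaw_iff {Ω : ℕ → Type*} [∀ N, MeasurableSpace (Ω N)]
    (μ : ∀ N, Measure (Ω N)) [∀ N, IsFiniteMeasure (μ N)] {Z : ∀ N, Ω N → ℝ}
    (hZ : ∀ N, Measurable (Z N)) (ν : Measure ℝ) [IsFiniteMeasure ν] :
    ConvergesInLaw μ Z ν ↔
      ∀ f : ℝ →ᵇ ℝ, Tendsto (fun N => ∫ ω, f (Z N ω) ∂μ N) atTop (𝓝 (∫ x, f x ∂ν)) := by
  rw [ConvergesInLaw, FiniteMeasure.tendsto_iff_forall_integral_tendsto]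
  refine forall_congr' fun f => ?_
  have : ∀ N, ∫ x, f x ∂(((bundle (μ N)).map (Z N) : FiniteMeasure ℝ) : Measure ℝ)
      = ∫ ω, f (Z N ω) ∂μ N := fun N => by
    change ∫ x, f x ∂((μ N).map (Z N)) = _
    rw [integral_map (hZ N).aemeasurable (by fun_prop)]
  simp only [this]
  rfl

/-! ### Central limit theorem for the standardized counts. -/

section CentralLimit

variable {ι : Type*} [Fintype ι]

/-- The unit vector with coordinates `√p i`. -/
noncomputable def sqrtVec (p : ι → ℝ) : EuclideanSpace ℝ ι := WithLp.toLp 2 fun i => √(p i)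

/-- The vector of standardized counts. -/
noncomputable def standardize (N : ℕ) (p : ι → ℝ) (y : ι → ℕ) : EuclideanSpace ℝ ι :=
  WithLp.toLp 2 fun i => ((y i : ℝ) - N * p i) / (√N * √(p i))

theorem measurable_standardize (N : ℕ) (p : ι → ℝ) : Measurable (standardize N p) :=
  Measurable.of_discrete

theorem multinomialProb_nonneg {p : ι → ℝ} (hp : ∀ i, 0 ≤ p i) (y : ι → ℕ) :
    0 ≤ multinomialProb p y :=
  mul_nonneg (Nat.cast_nonneg _) (Finset.prod_nonneg fun i _ => pow_nonneg (hp i) _)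

theorem integral_multinomial [DecidableEq ι] (N : ℕ) {p : ι → ℝ} (hp : ∀ i, 0 ≤ p i)
    (f : (ι → ℕ) → ℂ) :
    ∫ y, f y ∂multinomial N p =
      ∑ y ∈ Finset.piAntidiag Finset.univ N, (multinomialProb p y : ℂ) * f y := by
  have hf (y : ι → ℕ) : Integrable f (ENNReal.ofReal (multinomialProb p y) • Measure.dirac y) :=
    (integrable_dirac (by simp)).smul_measure ENNReal.ofReal_ne_top
  rw [multinomial, integral_finsetSum_measure fun y _ => hf y]
  refine Finset.sum_congr rfl fun y _ => ?_
  rw [integral_smul_measure, integral_dirac, ENNReal.toReal_ofReal (multinomialProb_nonneg hp y),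
    Complex.real_smul]

theorem multinomial_sum_ne [DecidableEq ι] (N : ℕ) (p : ι → ℝ) :
    multinomial N p {y | ∑ i, y i ≠ N} = 0 := by
  simp only [multinomial, Measure.finsetSum_apply, Measure.smul_apply, smul_eq_mul]
  refine Finset.sum_eq_zero fun y hy => ?_
  rw [Measure.dirac_apply' _ (MeasurableSet.of_discrete), Set.indicator_of_notMem, mul_zero]
  simpa using (Finset.mem_piAntidiag.1 hy).1

/-- Because the counts add up to `N`, the centring can be shared equally among the trials. The
exponential then factors over cells and the multinomial theorem collapses the sum to an `N`-th
power. -/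
theorem charFun_standardize [DecidableEq ι] (N : ℕ) {p : ι → ℝ} (hp : ∀ i, 0 < p i)
    (t : EuclideanSpace ℝ ι) :
    charFun ((multinomial N p).map (standardize N p)) t =
      (∑ i, (p i : ℂ) *
        Complex.exp (((t i / √(p i) - inner ℝ (sqrtVec p) t) / √N : ℝ) * Complex.I)) ^ N := by
  rw [charFun_apply, integral_map (measurable_standardize N p).aemeasurable (by fun_prop),
    integral_multinomial N fun i => (hp i).le, Finset.sum_pow_eq_sum_piAntidiag]
  refine Finset.sum_congr rfl fun y hy => ?_
  have hy' : ∑ i, (y i : ℝ) = N := by exact_mod_cast (Finset.mem_piAntidiag.1 hy).1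
  have key : inner ℝ (standardize N p y) t =
      ∑ i, (y i : ℝ) * ((t i / √(p i) - inner ℝ (sqrtVec p) t) / √N) := by
    simp_rw [sub_div, mul_sub, Finset.sum_sub_distrib, ← Finset.sum_mul, hy']
    simp only [standardize, sqrtVec, PiLp.inner_apply, RCLike.inner_apply, conj_trivial,
      Finset.sum_div, Finset.mul_sum, ← Finset.sum_sub_distrib]
    refine Finset.sum_congr rfl fun i _ => ?_
    have h1 : √(p i) ≠ 0 := (Real.sqrt_pos.2 (hp i)).ne'
    rcases eq_or_ne (√(N : ℝ)) 0 with h0 | h0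
    · simp [h0]
    · have h2 : p i = √(p i) ^ 2 := (Real.sq_sqrt (hp i).le).symm
      generalize √(p i) = s at *
      rw [h2]
      field_simp
  rw [key]
  simp only [multinomialProb, mul_pow, Finset.prod_mul_distrib]
  push_cast
  rw [Finset.sum_mul, Complex.exp_sum, mul_assoc]
  congr 2
  refine Finset.prod_congr rfl fun i _ => ?_
  rw [← Complex.exp_nat_mul]
  congr 1
  ring

/-- With `x = c / √N`, the Taylor remainder after the quadratic term is at most `|x| ^ 3`, and `N
|x| ^ 3 = c ^ 2 |x|` tends to zero. -/
theorem tendsto_mul_exp_sub_one_sub (c : ℝ) :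
    Tendsto (fun N : ℕ => (N : ℂ) *
      (Complex.exp ((c / √N : ℝ) * Complex.I) - 1 - (c / √N : ℝ) * Complex.I)) atTop
      (𝓝 (-(c : ℂ) ^ 2 / 2)) := by
  have hs : Tendsto (fun N : ℕ => √(N : ℝ)) atTop atTop :=
    Real.tendsto_sqrt_atTop.comp tendsto_natCast_atTop_atTop
  have h0 : Tendsto (fun N : ℕ => c / √(N : ℝ)) atTop (𝓝 0) := hs.const_div_atTop c
  rw [tendsto_iff_norm_sub_tendsto_zero]
  have hb : Tendsto (fun N : ℕ => c ^ 2 * |c / √(N : ℝ)|) atTop (𝓝 0) := by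
    simpa using (h0.abs).const_mul (c ^ 2)
  refine squeeze_zero' (Eventually.of_forall fun _ => norm_nonneg _) ?_ hb
  filter_upwards [h0.abs.eventually (ge_mem_nhds (by simp : |(0 : ℝ)| < 1)),
    eventually_gt_atTop 0] with N hN hpos
  set x : ℝ := c / √N with hx
  have hNx : (N : ℝ) * x ^ 2 = c ^ 2 := by
    rw [hx, div_pow, Real.sq_sqrt (Nat.cast_nonneg _)]
    field_simp
  have hxn : ‖(x : ℂ) * Complex.I‖ = |x| := by simp
  have hbd := Complex.exp_bound (x := (x : ℂ) * Complex.I) (by rw [hxn]; exact hN)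
    (n := 3) (by norm_num)
  have hNx' : (N : ℂ) * (x : ℂ) ^ 2 = (c : ℂ) ^ 2 := by exact_mod_cast hNx
  have heq : (N : ℂ) * (Complex.exp (x * Complex.I) - 1 - x * Complex.I) - -(c : ℂ) ^ 2 / 2 =
      N * (Complex.exp (x * Complex.I) -
        ∑ m ∈ Finset.range 3, ((x : ℂ) * Complex.I) ^ m / (m.factorial : ℂ)) := by
    rw [← hNx']
    simp only [Finset.sum_range_succ, Finset.sum_range_zero, mul_pow, Complex.I_sq]
    norm_num
    ring
  rw [heq, norm_mul, Complex.norm_natCast]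
  rw [hxn] at hbd
  calc (N : ℝ) * _ ≤ N * (|x| ^ 3 * 1) := by
        gcongr
        refine hbd.trans ?_
        gcongr
        norm_num [Nat.factorial]
    _ = c ^ 2 * |x| := by rw [← hNx, ← sq_abs x]; ring

/-- The single-trial scores `c i` have mean zero and variance `‖t‖ ^ 2 - ⟪√p, t⟫ ^ 2` under `p`; the
mean kills the linear term and the variance appears in the limit of `(1 + g N) ^ N`. -/
theorem tendsto_charFun_standardize [DecidableEq ι] {p : ι → ℝ} (hp : ∀ i, 0 < p i)
    (hsum : ∑ i, p i = 1) (t : EuclideanSpace ℝ ι) :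
    Tendsto (fun N => charFun ((multinomial N p).map (standardize N p)) t) atTop
      (𝓝 (Complex.exp (-((‖t‖ ^ 2 - inner ℝ (sqrtVec p) t ^ 2 : ℝ) : ℂ) / 2))) := by
  set c : ι → ℝ := fun i => t i / √(p i) - inner ℝ (sqrtVec p) t with hc
  have hin : inner ℝ (sqrtVec p) t = ∑ i, √(p i) * t i := by
    simp [sqrtVec, PiLp.inner_apply, mul_comm]
  have hdiv i : p i * (t i / √(p i)) = √(p i) * t i := by
    have h1 : √(p i) ≠ 0 := (Real.sqrt_pos.2 (hp i)).ne'
    field_simp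
    rw [Real.sq_sqrt (hp i).le]
    ring
  have hc1 : ∑ i, p i * c i = 0 := by
    simp only [hc, mul_sub, Finset.sum_sub_distrib, ← Finset.sum_mul, hsum, hdiv, one_mul, ← hin,
      sub_self]
  have hc2 : ∑ i, p i * c i ^ 2 = ‖t‖ ^ 2 - inner ℝ (sqrtVec p) t ^ 2 := by
    have : ∀ i, p i * c i ^ 2 = t i ^ 2 - 2 * inner ℝ (sqrtVec p) t * (√(p i) * t i)
        + p i * inner ℝ (sqrtVec p) t ^ 2 := fun i => by
      have h1 : √(p i) ≠ 0 := (Real.sqrt_pos.2 (hp i)).ne'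
      have h2 : p i * (t i / √(p i)) ^ 2 = t i ^ 2 := by
        rw [div_pow, Real.sq_sqrt (hp i).le]
        field_simp [(hp i).ne']
      rw [← hdiv, hc]
      linear_combination h2
    simp only [this, Finset.sum_add_distrib, Finset.sum_sub_distrib, ← Finset.mul_sum, ← hin,
      ← Finset.sum_mul, hsum, EuclideanSpace.norm_sq_eq, Real.norm_eq_abs, sq_abs]
    ring
  simp_rw [charFun_standardize _ hp t]
  have hlim : Tendsto (fun N : ℕ => ∑ i, (p i : ℂ) * ((N : ℂ) *
      (Complex.exp ((c i / √N : ℝ) * Complex.I) - 1 - (c i / √N : ℝ) * Complex.I))) atTop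
      (𝓝 (∑ i, (p i : ℂ) * (-(c i : ℂ) ^ 2 / 2))) :=
    tendsto_finsetSum _ fun i _ => (tendsto_mul_exp_sub_one_sub (c i)).const_mul _
  have hval : ∑ i, (p i : ℂ) * (-(c i : ℂ) ^ 2 / 2) =
      -((‖t‖ ^ 2 - inner ℝ (sqrtVec p) t ^ 2 : ℝ) : ℂ) / 2 := by
    rw [← hc2, Complex.ofReal_sum, ← Finset.sum_neg_distrib, Finset.sum_div]
    refine Finset.sum_congr rfl fun i _ => ?_
    push_cast
    ring
  rw [hval] at hlim
  have hsumC : ∑ i, (p i : ℂ) = 1 := by exact_mod_cast hsum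
  refine (Complex.tendsto_one_add_pow_exp_of_tendsto
    (g := fun N => (∑ i, (p i : ℂ) * Complex.exp ((c i / √N : ℝ) * Complex.I)) - 1)
    (hlim.congr fun N => ?_)).congr fun N => by rw [add_sub_cancel]
  have hcC : ∑ i, (p i : ℂ) * ((c i / √N : ℝ) * Complex.I) = 0 := by
    have : ∑ i, p i * (c i / √(N : ℝ)) = 0 := by
      simp only [mul_div_assoc', ← Finset.sum_div, hc1, zero_div]
    simp only [← mul_assoc, ← Finset.sum_mul]
    exact_mod_cast (by rw [this]; simp)
  have : ∀ i, (p i : ℂ) * ((N : ℂ) *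
      (Complex.exp ((c i / √N : ℝ) * Complex.I) - 1 - (c i / √N : ℝ) * Complex.I)) =
      N * ((p i : ℂ) * Complex.exp ((c i / √N : ℝ) * Complex.I)) - N * p i -
        N * ((p i : ℂ) * ((c i / √N : ℝ) * Complex.I)) := fun i => by ring
  simp only [this, Finset.sum_sub_distrib, ← Finset.mul_sum, hcC, hsumC]
  ring

/-- Pointwise convergence of characteristic functions to a characteristic-type limit continuous at
the origin gives tightness, hence one radius valid for every `N`. -/
theorem exists_norm_bound_standardize [DecidableEq ι] {p : ι → ℝ} (hp : ∀ i, 0 < p i)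
    (hsum : ∑ i, p i = 1) {ε : ENNReal} (hε : 0 < ε) :
    ∃ M : ℝ, ∀ N, multinomial N p {y | M < ‖standardize N p y‖} ≤ ε := by
  have hprob N := isProbabilityMeasure_multinomial N p (fun i => (hp i).le) hsum
  have hprob' N : IsProbabilityMeasure ((multinomial N p).map (standardize N p)) :=
    Measure.isProbabilityMeasure_map (measurable_standardize N p).aemeasurable
  have htight := isTightMeasureSet_of_tendsto_charFun
    (μ := fun N => (multinomial N p).map (standardize N p)) (by fun_prop)
    (tendsto_charFun_standardize hp hsum)
  obtain ⟨C, hC, hle⟩ := isTightMeasureSet_iff_exists_isCompact_measure_compl_le.1 htight ε hε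
  obtain ⟨M, hM⟩ := hC.isBounded.exists_norm_le
  refine ⟨M, fun N => ?_⟩
  refine le_trans ?_ (hle _ ⟨N, rfl⟩)
  rw [Measure.map_apply (measurable_standardize N p) hC.measurableSet.compl]
  exact measure_mono fun y hy hyC => (hM _ hyC).not_gt hy

theorem map_norm_sq_stdGaussian {E : Type*} [NormedAddCommGroup E] [InnerProductSpace ℝ E]
    [FiniteDimensional ℝ E] [MeasurableSpace E] [BorelSpace E] {K : ℕ}
    (hK : Module.finrank ℝ E = K) :
    (stdGaussian E).map (fun x => ‖x‖ ^ 2) = chiSquared K := by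
  let b : OrthonormalBasis (Fin K) ℝ E := (stdOrthonormalBasis ℝ E).reindex (finCongr hK)
  rw [stdGaussian_eq_map_pi_orthonormalBasis b, chiSquared,
    Measure.map_map (by fun_prop) (by fun_prop)]
  congr 1
  ext x
  have : ∑ i, x i • b i = b.repr.symm (WithLp.toLp 2 x) := (b.sum_repr_symm _)
  simp only [Function.comp_apply]
  rw [this, LinearIsometryEquiv.norm_map, EuclideanSpace.norm_sq_eq]
  simp

/-- For `t ∈ V` the term `⟪√p, t⟫ ^ 2` of the limit vanishes, leaving the characteristic function of
the standard Gaussian on `V`; Lévy's theorem and the continuous map `‖·‖ ^ 2` finish. -/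
theorem tendsto_integral_norm_sq_projection [DecidableEq ι] {p : ι → ℝ} (hp : ∀ i, 0 < p i)
    (hsum : ∑ i, p i = 1) (V : Submodule ℝ (EuclideanSpace ℝ ι))
    (hV : ∀ x ∈ V, inner ℝ (sqrtVec p) x = 0) {K : ℕ} (hK : Module.finrank ℝ V = K)
    (f : ℝ →ᵇ ℝ) :
    Tendsto (fun N => ∫ y, f (‖V.orthogonalProjectionOnto (standardize N p y)‖ ^ 2) ∂multinomial N p)
      atTop (𝓝 (∫ x, f x ∂chiSquared K)) := by
  have hprob N := isProbabilityMeasure_multinomial N p (fun i => (hp i).le) hsum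
  let L := V.orthogonalProjectionOnto
  have hm N : Measurable fun y => L (standardize N p y) := Measurable.of_discrete
  let μ : ℕ → ProbabilityMeasure V := fun N => ⟨(multinomial N p).map fun y =>
    L (standardize N p y), Measure.isProbabilityMeasure_map (hm N).aemeasurable⟩
  let μ₀ : ProbabilityMeasure V := ⟨stdGaussian V, inferInstance⟩
  have hlim : Tendsto μ atTop (𝓝 μ₀) := by
    refine ProbabilityMeasure.tendsto_of_tendsto_charFun fun t => ?_
    have h := tendsto_charFun_standardize hp hsum (t : EuclideanSpace ℝ ι)
    have h1 : charFun (μ₀ : Measure V) t =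
        Complex.exp (-((‖(t : EuclideanSpace ℝ ι)‖ ^ 2 -
          inner ℝ (sqrtVec p) (t : EuclideanSpace ℝ ι) ^ 2 : ℝ) : ℂ) / 2) := by
      change charFun (stdGaussian V) t = _
      rw [charFun_stdGaussian, hV t t.2]
      simp
    rw [h1]
    refine h.congr fun N => ?_
    change _ = charFun ((multinomial N p).map fun y => L (standardize N p y)) t
    rw [charFun_apply, charFun_apply, integral_map (hm N).aemeasurable (by fun_prop),
      integral_map (measurable_standardize N p).aemeasurable (by fun_prop)]
    refine integral_congr_ae (ae_of_all _ fun y => ?_)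
    simp only [L, Submodule.inner_orthogonalProjectionOnto_eq_of_mem_right]
  have h2 := ProbabilityMeasure.tendsto_iff_forall_integral_tendsto.1 hlim
    (f.compContinuous ⟨fun x : V => ‖x‖ ^ 2, by fun_prop⟩)
  rw [← map_norm_sq_stdGaussian hK, integral_map (by fun_prop) (by fun_prop)]
  refine h2.congr fun N => ?_
  change ∫ x, f (‖x‖ ^ 2) ∂((multinomial N p).map fun y => L (standardize N p y)) = _
  rw [integral_map (hm N).aemeasurable (by fun_prop)]

end CentralLimit

/-! ### Existence of the MLE and the likelihood equations. -/

section Likelihood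

variable {κ ι : Type*} [Fintype κ] [Fintype ι] {A : Matrix κ ι ℝ} {p : ι → ℝ} {y : ι → ℕ}

theorem isMLE_iff : IsMLE A y p ↔ p ∈ modelProb A ∧
    ∀ q ∈ modelProb A, ∑ i, (y i : ℝ) * Real.log (q i) ≤ ∑ i, (y i : ℝ) * Real.log (p i) := by
  refine and_congr_right fun hp => forall₂_congr fun q hq => ?_
  have hpos : ∀ {r : ι → ℝ}, r ∈ modelProb A → 0 < ∏ i, r i ^ y i := fun hr =>
    Finset.prod_pos fun i _ => pow_pos (hr.1 i) _
  have hlog : ∀ {r : ι → ℝ}, r ∈ modelProb A →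
      Real.log (∏ i, r i ^ y i) = ∑ i, (y i : ℝ) * Real.log (r i) := fun hr => by
    rw [Real.log_prod fun i _ => (pow_pos (hr.1 i) _).ne']
    simp only [Real.log_pow]
  have hM : (0 : ℝ) < Nat.multinomial Finset.univ y := by
    exact_mod_cast Nat.multinomial_pos _ _
  change multinomialProb q y ≤ multinomialProb p y ↔ _
  simp only [multinomialProb]
  rw [mul_le_mul_iff_right₀ hM, ← Real.log_le_log_iff (hpos hq) (hpos hp), hlog hq, hlog hp]

theorem mem_modelProb_exp {θ : κ → ℝ} (h : ∑ i, Real.exp (A.transpose.mulVec θ i) = 1) :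
    (fun i => Real.exp (A.transpose.mulVec θ i)) ∈ modelProb A :=
  ⟨fun _ => Real.exp_pos _, h, θ, by simp⟩

/-- In the coordinates `η = log q`, the vectors at least as likely as `p` form a compact set: `η ≤
0` always, and since each count is at least one, no `η i` can be below the total log-likelihood `c`.
-/
theorem mem_mleExists_of_pos (hp : p ∈ modelProb A) (hy : ∀ i, 0 < y i) : y ∈ mleExists A := by
  classical
  let R : Submodule ℝ (ι → ℝ) := LinearMap.range A.transpose.mulVecLin
  set c : ℝ := ∑ i, (y i : ℝ) * Real.log (p i) with hc
  let S : Set (ι → ℝ) := {η | η ∈ R ∧ ∑ i, Real.exp (η i) = 1 ∧ c ≤ ∑ i, (y i : ℝ) * η i}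
  have hcl : IsClosed S := by
    refine R.closed_of_finiteDimensional.inter (IsClosed.inter ?_ ?_)
    · exact isClosed_eq (f := fun η : ι → ℝ => ∑ i, Real.exp (η i)) (by fun_prop) continuous_const
    · exact isClosed_le (f := fun _ : ι → ℝ => c) (g := fun η => ∑ i, (y i : ℝ) * η i)
        (by fun_prop) (by fun_prop)
  have hS : S ⊆ Set.Icc (fun _ => c) 0 := by
    rintro η ⟨-, h1, h2⟩
    have hη : ∀ i, η i ≤ 0 := fun i => by
      rw [← Real.exp_le_one_iff, ← h1]
      exact Finset.single_le_sum (f := fun i => Real.exp (η i)) (fun j _ => (Real.exp_pos _).le)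
        (Finset.mem_univ i)
    refine ⟨fun i => ?_, hη⟩
    have h3 : ∑ j, (y j : ℝ) * η j ≤ (y i : ℝ) * η i := by
      rw [← Finset.add_sum_erase _ _ (Finset.mem_univ i)]
      have : ∑ j ∈ Finset.univ.erase i, (y j : ℝ) * η j ≤ 0 :=
        Finset.sum_nonpos fun j _ => mul_nonpos_of_nonneg_of_nonpos (Nat.cast_nonneg _) (hη j)
      linarith
    have h4 : (1 : ℝ) ≤ y i := by exact_mod_cast hy i
    nlinarith [hη i]
  have hne : S.Nonempty := by
    obtain ⟨h1, h2, θ, hθ⟩ := hp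
    refine ⟨fun i => Real.log (p i), ⟨θ, hθ.symm⟩, ?_, le_rfl⟩
    simp only [Real.exp_log (h1 _), h2]
  obtain ⟨η, ⟨⟨θ, rfl⟩, h1, h2⟩, hmax⟩ := (isCompact_Icc.of_isClosed_subset hcl hS).exists_isMaxOn
    hne (f := fun η => ∑ i, (y i : ℝ) * η i) (by fun_prop)
  simp only [Matrix.mulVecLin_apply] at h1 h2 hmax
  refine ⟨_, isMLE_iff.2 ⟨mem_modelProb_exp h1, fun q hq => ?_⟩⟩
  simp only [Real.log_exp]
  by_cases hcq : c ≤ ∑ i, (y i : ℝ) * Real.log (q i)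
  · obtain ⟨h1, h2, θ', hθ'⟩ := hq
    refine hmax (a := fun i => Real.log (q i)) ⟨⟨θ', hθ'.symm⟩, ?_, hcq⟩
    simp only [Real.exp_log (h1 _), h2]
  · exact (not_le.1 hcq).le.trans h2

theorem IsDesignMatrix.transpose_mulVec_one_pos (hA : IsDesignMatrix A) (i : ι) :
    0 < A.transpose.mulVec 1 i := by
  simp only [Matrix.mulVec, dotProduct, Matrix.transpose_apply, Pi.one_apply, mul_one]
  obtain ⟨j, hj⟩ := hA.one_in_column i
  refine Finset.sum_pos' (fun k _ => ?_) ⟨j, Finset.mem_univ _, by rw [hj]; exact one_pos⟩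
  rcases hA.zero_or_one k i with h | h <;> simp [h]

theorem IsDesignMatrix.sum_mul_transpose_mulVec_one_pos (hA : IsDesignMatrix A)
    (hp : p ∈ modelProb A) : 0 < ∑ i, p i * A.transpose.mulVec 1 i := by
  have : (Finset.univ : Finset ι).Nonempty := by
    rw [Finset.nonempty_iff_ne_empty]
    intro h
    have := hp.2.1
    simp [h] at this
  exact Finset.sum_pos (fun i _ => mul_pos (hp.1 i) (hA.transpose_mulVec_one_pos i)) this

/-- Lagrange multipliers for the constraint of total mass one give only proportionality of `A y` and
`A p`, since the constant vector need not be in the row space. The factor is eliminated by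
cross-multiplying with the direction `θ = 1`. -/
theorem IsMLE.sum_mul_sum_eq (hA : IsDesignMatrix A) (h : IsMLE A y p) (θ : κ → ℝ) :
    (∑ i, (y i : ℝ) * A.transpose.mulVec θ i) * ∑ i, p i * A.transpose.mulVec 1 i =
      (∑ i, p i * A.transpose.mulVec θ i) * ∑ i, (y i : ℝ) * A.transpose.mulVec 1 i := by
  have hpm := h.1
  obtain ⟨hpos, hsum, θ₀, hθ₀⟩ := h.1
  let ℓ : ι → StrongDual ℝ (κ → ℝ) := fun i =>
    LinearMap.toContinuousLinearMap ((LinearMap.proj i).comp A.transpose.mulVecLin)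
  have hℓ : ∀ i θ, ℓ i θ = A.transpose.mulVec θ i := fun _ _ => rfl
  have hexp : ∀ i, Real.exp (ℓ i θ₀) = p i := fun i => by
    rw [hℓ, ← congrFun hθ₀ i, Real.exp_log (hpos i)]
  have hf : HasStrictFDerivAt (fun θ => ∑ i, Real.exp (ℓ i θ))
      (∑ i, Real.exp (ℓ i θ₀) • ℓ i) θ₀ :=
    HasStrictFDerivAt.fun_sum fun i _ => (ℓ i).hasStrictFDerivAt.exp
  have hφ : HasStrictFDerivAt (fun θ => ∑ i, (y i : ℝ) * ℓ i θ) (∑ i, (y i : ℝ) • ℓ i) θ₀ :=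
    HasStrictFDerivAt.fun_sum fun i _ => (ℓ i).hasStrictFDerivAt.const_mul _
  have hext : IsLocalExtrOn (fun θ => ∑ i, (y i : ℝ) * ℓ i θ)
      {θ | ∑ i, Real.exp (ℓ i θ) = ∑ i, Real.exp (ℓ i θ₀)} θ₀ := by
    refine Or.inr (IsMaxOn.localize fun θ' hθ' => ?_)
    have h1 : ∑ i, Real.exp (ℓ i θ') = 1 := by
      refine (show _ = _ from hθ').trans ?_; simp only [hexp, hsum]
    have h2 := (isMLE_iff.1 h).2 _ (mem_modelProb_exp h1)
    simp only [Real.log_exp] at h2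
    refine h2.trans (le_of_eq (Finset.sum_congr rfl fun i _ => ?_))
    rw [hℓ, ← congrFun hθ₀ i]
  obtain ⟨a, b, hab, heq⟩ := hext.exists_multipliers_of_hasStrictFDerivAt_1d hf hφ
  have hall : ∀ θ : κ → ℝ, a * (∑ i, p i * A.transpose.mulVec θ i) +
      b * ∑ i, (y i : ℝ) * A.transpose.mulVec θ i = 0 := fun θ => by
    have := congrArg (fun L => L θ) heq
    simp only [hexp] at this
    simpa [hℓ] using this
  -- Every column of `A` contains a one, so `A' 1` is positive. This direction forces `b ≠ 0`, as
  -- otherwise both multipliers would vanish.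
  have hv := hall 1
  have hPv := hA.sum_mul_transpose_mulVec_one_pos hpm
  have hb : b ≠ 0 := by
    rintro rfl
    rw [zero_mul, add_zero] at hv
    rcases mul_eq_zero.1 hv with h | h
    · exact hab (by rw [h]; rfl)
    · exact hPv.ne' h
  refine mul_left_cancel₀ hb ?_
  linear_combination (∑ i, p i * A.transpose.mulVec 1 i) * hall θ -
    (∑ i, p i * A.transpose.mulVec θ i) * hv

end Likelihood

/-! ### Root-`N` rate for the logarithms of the estimate. -/

section Rate

theorem exp_half_sub_one_sq_le (x : ℝ) : (Real.exp (x / 2) - 1) ^ 2 ≤ Real.exp x - 1 - x := by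
  have h1 : Real.exp x = Real.exp (x / 2) ^ 2 := by
    rw [← Real.exp_nat_mul]; congr 1; push_cast; ring
  have h2 := Real.add_one_le_exp (x / 2)
  rw [h1]; nlinarith

theorem mul_sq_le_exp_half_sub_one_sq {B x : ℝ} (hB : 0 ≤ B) (hx : -B ≤ x) :
    (Real.exp (-B / 2) / 2) ^ 2 * x ^ 2 ≤ (Real.exp (x / 2) - 1) ^ 2 := by
  rw [← mul_pow]
  refine sq_le_sq.2 ?_
  have hE := Real.exp_pos (-B / 2)
  have hE1 : Real.exp (-B / 2) ≤ 1 := Real.exp_le_one_iff.2 (by linarith)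
  rw [abs_mul, abs_of_pos (by positivity : 0 < Real.exp (-B / 2) / 2)]
  rcases le_total 0 x with h | h
  · have h2 := Real.add_one_le_exp (x / 2)
    rw [abs_of_nonneg h, abs_of_nonneg (by linarith)]
    nlinarith
  · have h3 : Real.exp (x / 2) ≤ 1 := Real.exp_le_one_iff.2 (by linarith)
    rw [abs_of_nonpos h, abs_of_nonpos (by linarith)]
    have h4 : Real.exp (x / 2) * Real.exp (-x / 2) = 1 := by
      rw [← Real.exp_add]; simp; ring
    have h5 := Real.add_one_le_exp (-x / 2)
    have h6 : Real.exp (-B / 2) ≤ Real.exp (x / 2) := Real.exp_le_exp.2 (by linarith)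
    nlinarith [Real.exp_pos (x / 2)]

/-- Here `q` plays the observed frequencies. With `d = log p' - log p`, the divergence `∑ p (exp d -
1 - d)` equals `-∑ p d`, which is at most `∑ (q - p) d ≤ δ ∑ |d|` because `p'` is at least as likely
as `p`. It is also at least a constant times `∑ d ^ 2`, so `d = O(δ)`. No prior consistency argument
is needed. -/
theorem exists_abs_log_sub_log_le {ι : Type*} [Fintype ι] {p : ι → ℝ} (hp : ∀ i, 0 < p i)
    (hsum : ∑ i, p i = 1) {m : ℝ} (hm : 0 < m) (hmp : ∀ i, m ≤ p i) :
    ∃ C : ℝ, 0 ≤ C ∧ ∀ (q p' : ι → ℝ) (δ : ℝ), (∀ i, 0 < p' i) → ∑ i, p' i = 1 →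
      (∀ i, m ≤ q i) → ∑ i, q i = 1 → (∀ i, |q i - p i| ≤ δ) →
      ∑ i, q i * Real.log (p i) ≤ ∑ i, q i * Real.log (p' i) →
      ∀ i, |Real.log (p' i) - Real.log (p i)| ≤ C * δ := by
  classical
  have hm1 : ∀ {r : ι → ℝ}, (∀ i, 0 < r i) → ∑ i, r i = 1 → ∀ i, Real.log (r i) ≤ 0 :=
    fun hr hr1 i => Real.log_nonpos (hr i).le
      (hr1 ▸ Finset.single_le_sum (fun j _ => (hr j).le) (Finset.mem_univ i))
  have hlogm : ∀ i, Real.log m ≤ Real.log (p i) := fun i => Real.log_le_log hm (hmp i)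
  -- `-B` bounds `log p'` below: `m log (p' i) ≥ ∑ q log p' ≥ ∑ q log p ≥ log m`. This makes the
  -- quadratic lower bound on `exp d - 1 - d` uniform.
  set B : ℝ := |Real.log m| / m with hB
  have hB0 : 0 ≤ B := by positivity
  set c : ℝ := (Real.exp (-B / 2) / 2) ^ 2 with hc
  have hc0 : 0 < c := by positivity
  refine ⟨Fintype.card ι / (m * c), by positivity, fun q p' δ hp' hsum' hq hqsum hδ hle i => ?_⟩
  set d : ι → ℝ := fun i => Real.log (p' i) - Real.log (p i) with hd
  have hdB : ∀ i, -B ≤ d i := fun i => by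
    have h1 : ∑ j, q j * Real.log (p' j) ≤ q i * Real.log (p' i) := by
      rw [← Finset.add_sum_erase _ _ (Finset.mem_univ i)]
      have : ∑ j ∈ Finset.univ.erase i, q j * Real.log (p' j) ≤ 0 :=
        Finset.sum_nonpos fun j _ =>
          mul_nonpos_of_nonneg_of_nonpos (hm.le.trans (hq j)) (hm1 hp' hsum' j)
      linarith
    have h2 : Real.log m ≤ ∑ j, q j * Real.log (p j) := by
      calc Real.log m = ∑ j, q j * Real.log m := by rw [← Finset.sum_mul, hqsum, one_mul]
        _ ≤ _ := Finset.sum_le_sum fun j _ =>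
          mul_le_mul_of_nonneg_left (hlogm j) (hm.le.trans (hq j))
    have h3 : m * Real.log (p' i) ≥ q i * Real.log (p' i) := by
      nlinarith [hq i, hm1 hp' hsum' i]
    have h4 : -B ≤ Real.log (p' i) := by
      rw [hB, ← neg_div, div_le_iff₀ hm]
      linarith [neg_abs_le (Real.log m)]
    have := hm1 hp hsum i
    simp only [hd]; linarith
  have hexp : ∀ i, p i * Real.exp (d i) = p' i := fun i => by
    rw [hd, Real.exp_sub, Real.exp_log (hp' i), Real.exp_log (hp i)]
    field_simp [(hp i).ne']
  have h1 : 0 ≤ ∑ i, q i * d i := by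
    simp only [hd, mul_sub, Finset.sum_sub_distrib]; linarith
  have h2 : m * c * ∑ i, d i ^ 2 ≤ ∑ i, p i * (Real.exp (d i) - 1 - d i) := by
    rw [Finset.mul_sum]
    refine Finset.sum_le_sum fun i _ => ?_
    rw [mul_assoc]
    exact mul_le_mul (hmp i)
      ((mul_sq_le_exp_half_sub_one_sq hB0 (hdB i)).trans (exp_half_sub_one_sq_le _))
      (by positivity) (hp i).le
  have h3 : ∑ i, p i * (Real.exp (d i) - 1 - d i) = -∑ i, p i * d i := by
    simp only [mul_sub, hexp, Finset.sum_sub_distrib, mul_one, hsum, hsum']; ring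
  have h4 : ∑ i, q i * d i - ∑ i, p i * d i ≤ δ * ∑ i, |d i| := by
    rw [← Finset.sum_sub_distrib, Finset.mul_sum]
    refine Finset.sum_le_sum fun i _ => ?_
    rw [← sub_mul]
    refine (le_abs_self _).trans ?_
    rw [abs_mul]
    exact mul_le_mul_of_nonneg_right (hδ i) (abs_nonneg _)
  have h5 : (∑ i, |d i|) ^ 2 ≤ Fintype.card ι * ∑ i, d i ^ 2 := by
    simpa using sq_sum_le_card_mul_sum_sq (s := Finset.univ) (f := fun i => |d i|)
  have hle : |d i| ≤ ∑ i, |d i| :=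
    Finset.single_le_sum (f := fun i => |d i|) (fun j _ => abs_nonneg _) (Finset.mem_univ i)
  refine hle.trans ?_
  have hS0 : 0 ≤ ∑ i, |d i| := Finset.sum_nonneg fun j _ => abs_nonneg _
  have hδ0 : 0 ≤ δ := (abs_nonneg _).trans (hδ i)
  set S := ∑ i, |d i|
  have hcard : (0 : ℝ) ≤ Fintype.card ι := Nat.cast_nonneg _
  have hmc : 0 < m * c := by positivity
  rw [div_mul_eq_mul_div, le_div_iff₀ hmc]
  rcases hS0.eq_or_lt with h0 | h0
  · rw [← h0, zero_mul]; positivity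
  · have h6 : m * c * ∑ i, d i ^ 2 ≤ δ * S := by linarith
    have h7 : m * c * S ^ 2 ≤ Fintype.card ι * (δ * S) := by
      calc m * c * S ^ 2 ≤ m * c * (Fintype.card ι * ∑ i, d i ^ 2) := by gcongr
        _ = Fintype.card ι * (m * c * ∑ i, d i ^ 2) := by ring
        _ ≤ _ := by gcongr
    refine le_of_mul_le_mul_right (a := S) ?_ h0
    linarith

end Rate

/-! ### The tangent space of the model and the degrees of freedom. -/

section Tangent

variable {κ ι : Type*} [Fintype κ] [Fintype ι]

/-- The span of `√p` and of the tangent space of the model at `p`, in the coordinates of the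
standardized counts. -/
noncomputable def tangentSpan (A : Matrix κ ι ℝ) (p : ι → ℝ) :
    Submodule ℝ (EuclideanSpace ℝ ι) :=
  Submodule.span ℝ (insert (sqrtVec p) {x | ∃ θ : κ → ℝ,
    ∑ i, p i * A.transpose.mulVec θ i = 0 ∧
      x = WithLp.toLp 2 fun i => √(p i) * A.transpose.mulVec θ i})

variable {A : Matrix κ ι ℝ} {p : ι → ℝ}

theorem sqrtVec_mem_tangentSpan : sqrtVec p ∈ tangentSpan A p :=
  Submodule.subset_span (Set.mem_insert _ _)

theorem toLp_mem_tangentSpan {θ : κ → ℝ} (h : ∑ i, p i * A.transpose.mulVec θ i = 0) :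
    WithLp.toLp 2 (fun i => √(p i) * A.transpose.mulVec θ i) ∈ tangentSpan A p :=
  Submodule.subset_span (Set.mem_insert_of_mem _ ⟨θ, h, rfl⟩)

theorem mem_orthogonal_tangentSpan {x : EuclideanSpace ℝ ι} :
    x ∈ (tangentSpan A p)ᗮ ↔ ∑ i, √(p i) * x i = 0 ∧
      ∀ θ : κ → ℝ, ∑ i, p i * A.transpose.mulVec θ i = 0 →
        ∑ i, √(p i) * A.transpose.mulVec θ i * x i = 0 := by
  have h1 : inner ℝ (sqrtVec p) x = ∑ i, √(p i) * x i := by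
    simp [sqrtVec, PiLp.inner_apply, mul_comm]
  have h2 : ∀ θ, inner ℝ (WithLp.toLp 2 fun i => √(p i) * A.transpose.mulVec θ i) x =
      ∑ i, √(p i) * A.transpose.mulVec θ i * x i := fun θ => by
    simp only [PiLp.inner_apply, RCLike.inner_apply, conj_trivial]
    exact Finset.sum_congr rfl fun i _ => mul_comm _ _
  rw [Submodule.mem_orthogonal]
  constructor
  · intro h
    exact ⟨h1 ▸ h _ sqrtVec_mem_tangentSpan, fun θ hθ => h2 θ ▸ h _ (toLp_mem_tangentSpan hθ)⟩
  · rintro ⟨h3, h4⟩ u hu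
    induction hu using Submodule.span_induction with
    | mem u hu =>
      rcases hu with rfl | ⟨θ, hθ, rfl⟩
      · rw [h1, h3]
      · rw [h2, h4 θ hθ]
    | zero => simp
    | add u v _ _ hu hv => rw [inner_add_left, hu, hv, add_zero]
    | smul c u _ hu => rw [inner_smul_left, hu, mul_zero]

theorem sum_mul_transpose_mulVec (k : ι → ℝ) (θ : κ → ℝ) :
    ∑ i, k i * A.transpose.mulVec θ i = ∑ j, θ j * A.mulVec k j := by
  change k ⬝ᵥ A.transpose.mulVec θ = θ ⬝ᵥ A.mulVec k
  rw [Matrix.mulVec_transpose, dotProduct_comm, Matrix.dotProduct_mulVec]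

theorem mem_ker_iff_forall_sum {k : ι → ℝ} :
    k ∈ LinearMap.ker A.mulVecLin ↔ ∀ θ : κ → ℝ, ∑ i, k i * A.transpose.mulVec θ i = 0 := by
  classical
  simp only [sum_mul_transpose_mulVec, LinearMap.mem_ker, Matrix.mulVecLin_apply]
  constructor
  · intro h θ
    simp [h]
  · intro h
    ext j
    simpa [Pi.single_apply] using h (Pi.single j 1)

/-- The kernel pairs to zero with all of the row space, the orthogonal complement with its tangent
part and with the constants. Adding a suitable multiple of `p` passes from one condition to the
other; since `p` pairs positively both with `A' 1` and with the constants, both maps are injective.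
-/
theorem finrank_orthogonal_tangentSpan (hA : IsDesignMatrix A) (hp : p ∈ modelProb A) :
    Module.finrank ℝ (tangentSpan A p)ᗮ = Module.finrank ℝ (LinearMap.ker A.mulVecLin) := by
  have hpos := hp.1
  have hsum := hp.2.1
  have hv := hA.sum_mul_transpose_mulVec_one_pos hp
  set v : ι → ℝ := A.transpose.mulVec 1 with hvdef
  have hs i : 0 < √(p i) := Real.sqrt_pos.2 (hpos i)
  have hss i : √(p i) * √(p i) = p i := Real.mul_self_sqrt (hpos i).le
  apply le_antisymm
  · let c : EuclideanSpace ℝ ι →ₗ[ℝ] ℝ :=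
      { toFun := fun x => (∑ i, √(p i) * v i * x i) / ∑ i, p i * v i
        map_add' := fun x y => by simp [mul_add, Finset.sum_add_distrib, add_div]
        map_smul' := fun a x => by
          simp only [PiLp.smul_apply, smul_eq_mul, RingHom.id_apply, mul_div_assoc', Finset.mul_sum]
          congr 1
          exact Finset.sum_congr rfl fun i _ => by ring }
    let g : EuclideanSpace ℝ ι →ₗ[ℝ] (ι → ℝ) :=
      { toFun := fun x i => √(p i) * x i - c x * p i
        map_add' := fun x y => by ext i; simp; ring
        map_smul' := fun a x => by ext i; simp; ring }
    have hg : ∀ x ∈ (tangentSpan A p)ᗮ, g x ∈ LinearMap.ker A.mulVecLin := fun x hx => by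
      obtain ⟨-, h2⟩ := mem_orthogonal_tangentSpan.1 hx
      rw [mem_ker_iff_forall_sum]
      intro θ
      -- Subtracting `b` times the direction `1` makes an arbitrary `θ` tangent.
      set b := (∑ i, p i * A.transpose.mulVec θ i) / ∑ i, p i * v i with hb
      have hdir : ∀ i, A.transpose.mulVec (θ - b • 1) i = A.transpose.mulVec θ i - b * v i := by
        intro i
        rw [Matrix.mulVec_sub, Matrix.mulVec_smul]; rfl
      have h3 := h2 (θ - b • 1) (by
        simp only [hdir, mul_sub, Finset.sum_sub_distrib, mul_left_comm _ b, ← Finset.mul_sum]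
        rw [hb, div_mul_cancel₀ _ hv.ne', sub_self])
      have h4 : ∑ i, √(p i) * A.transpose.mulVec θ i * x i = b * ∑ i, √(p i) * v i * x i := by
        rw [Finset.mul_sum, ← sub_eq_zero, ← Finset.sum_sub_distrib, ← h3]
        refine Finset.sum_congr rfl fun i _ => ?_
        rw [hdir]; ring
      have h5 : ∑ i, g x i * A.transpose.mulVec θ i =
          ∑ i, √(p i) * A.transpose.mulVec θ i * x i - c x * ∑ i, p i * A.transpose.mulVec θ i := by
        rw [Finset.mul_sum, ← Finset.sum_sub_distrib]
        refine Finset.sum_congr rfl fun i _ => ?_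
        change (√(p i) * x i - c x * p i) * _ = _
        ring
      rw [h5, h4, hb]
      change _ - (∑ i, √(p i) * v i * x i) / (∑ i, p i * v i) * _ = 0
      ring
    refine LinearMap.finrank_le_finrank_of_injective
      (f := (g.comp (Submodule.subtype _)).codRestrict _ fun x => hg x x.2)
      ((injective_iff_map_eq_zero _).2 fun x hx => ?_)
    have h1 : ∀ i, √(p i) * (x : EuclideanSpace ℝ ι) i - c x * p i = 0 := fun i =>
      congrFun (congrArg Subtype.val hx) i
    have h2 := (mem_orthogonal_tangentSpan.1 x.2).1
    have h3 : c x = 0 := by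
      have : ∑ i, (√(p i) * (x : EuclideanSpace ℝ ι) i - c x * p i) = 0 :=
        Finset.sum_eq_zero fun i _ => h1 i
      rw [Finset.sum_sub_distrib, ← Finset.mul_sum, h2, hsum] at this
      linarith
    ext i
    have := h1 i
    rw [h3, zero_mul, sub_zero] at this
    simpa [(hs i).ne'] using this
  · let g : (ι → ℝ) →ₗ[ℝ] EuclideanSpace ℝ ι :=
      { toFun := fun k => WithLp.toLp 2 fun i => k i / √(p i) - (∑ i, k i) * √(p i)
        map_add' := fun k l => by ext i; simp [Finset.sum_add_distrib]; ring
        map_smul' := fun a k => by ext i; simp [← Finset.mul_sum]; ring }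
    have hgi : ∀ k i, √(p i) * g k i = k i - (∑ i, k i) * p i := fun k i => by
      change √(p i) * (k i / √(p i) - (∑ i, k i) * √(p i)) = _
      rw [mul_sub, mul_div_cancel₀ _ (hs i).ne']
      linear_combination (-∑ i, k i) * hss i
    have hg : ∀ k ∈ LinearMap.ker A.mulVecLin, g k ∈ (tangentSpan A p)ᗮ := fun k hk => by
      rw [mem_ker_iff_forall_sum] at hk
      refine mem_orthogonal_tangentSpan.2 ⟨?_, fun θ hθ => ?_⟩
      · simp only [hgi, Finset.sum_sub_distrib, ← Finset.mul_sum, hsum]; ring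
      · have : ∀ i, √(p i) * A.transpose.mulVec θ i * g k i =
            k i * A.transpose.mulVec θ i - (∑ i, k i) * (p i * A.transpose.mulVec θ i) := fun i => by
          rw [mul_right_comm, hgi]; ring
        simp only [this, Finset.sum_sub_distrib, ← Finset.mul_sum, hk, hθ]; ring
    refine LinearMap.finrank_le_finrank_of_injective
      (f := (g.comp (Submodule.subtype _)).codRestrict _ fun x => hg x x.2)
      ((injective_iff_map_eq_zero _).2 fun k hk => ?_)
    have h0 : g (k : ι → ℝ) = 0 := congrArg Subtype.val hk
    have h1 : ∀ i, (k : ι → ℝ) i = (∑ i, (k : ι → ℝ) i) * p i := fun i => by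
      have := hgi k i
      rw [h0] at this
      simp only [PiLp.zero_apply, mul_zero] at this
      linarith
    have h2 : (∑ i, (k : ι → ℝ) i) * ∑ i, p i * v i = 0 := by
      have := (mem_ker_iff_forall_sum.1 k.2) 1
      rw [← this, Finset.mul_sum]
      refine Finset.sum_congr rfl fun i _ => ?_
      rw [← mul_assoc, ← h1 i]
    have h3 : ∑ i, (k : ι → ℝ) i = 0 := (mul_eq_zero.1 h2).resolve_right hv.ne'
    ext i
    rw [h1 i, h3, zero_mul]; rfl

end Tangent

/-! ### Linearization of the estimate and limit of the residual, along an arbitrary filter. -/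

section Asymptotics

theorem tendsto_mul_zero_of_eventually_abs_le {α : Type*} {l : Filter α} {f g : α → ℝ} {M : ℝ}
    (hf : ∀ᶠ a in l, |f a| ≤ M) (hg : Tendsto g l (𝓝 0)) :
    Tendsto (fun a => f a * g a) l (𝓝 0) := by
  refine squeeze_zero_norm' (a := fun a => M * |g a|) ?_ (by simpa using hg.abs.const_mul M)
  filter_upwards [hf] with a ha
  rw [Real.norm_eq_abs, abs_mul]
  exact mul_le_mul_of_nonneg_right ha (abs_nonneg _)

variable {ι : Type*} {α : Type*} {l : Filter α} {N : α → ℕ} {p : ι → ℝ} {p' : α → ι → ℝ}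

theorem tendsto_const_div_sqrt (hN : Tendsto N l atTop) (c : ℝ) :
    Tendsto (fun a => c / √(N a : ℝ)) l (𝓝 0) :=
  ((Real.tendsto_sqrt_atTop.comp tendsto_natCast_atTop_atTop).comp hN).const_div_atTop c

theorem tendsto_of_abs_log_sub_le (hp : ∀ i, 0 < p i) (hN : Tendsto N l atTop)
    (hp' : ∀ᶠ a in l, ∀ i, 0 < p' a i) {D : ℝ}
    (hD : ∀ᶠ a in l, ∀ i, |Real.log (p' a i) - Real.log (p i)| ≤ D / √(N a)) (i : ι) :
    Tendsto (fun a => p' a i) l (𝓝 (p i)) := by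
  have h1 : Tendsto (fun a => Real.log (p' a i)) l (𝓝 (Real.log (p i))) := by
    rw [tendsto_iff_norm_sub_tendsto_zero]
    exact squeeze_zero' (Eventually.of_forall fun _ => norm_nonneg _) (hD.mono fun a ha => ha i)
      (tendsto_const_div_sqrt hN D)
  have h2 := (Real.continuous_exp.tendsto _).comp h1
  rw [Real.exp_log (hp i)] at h2
  exact h2.congr' (hp'.mono fun a ha => Real.exp_log (ha i))

/-- The first-order expansion of the estimated probabilities in their logarithms. -/
theorem tendsto_sqrt_mul_sub_sub (hp : ∀ i, 0 < p i) (hN : Tendsto N l atTop)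
    (hp' : ∀ᶠ a in l, ∀ i, 0 < p' a i) {D : ℝ}
    (hD : ∀ᶠ a in l, ∀ i, |Real.log (p' a i) - Real.log (p i)| ≤ D / √(N a)) (i : ι) :
    Tendsto (fun a => √(N a) * (p' a i - p i - p i * (Real.log (p' a i) - Real.log (p i)))) l
      (𝓝 0) := by
  refine squeeze_zero_norm' (a := fun a => p i * D ^ 2 / √(N a)) ?_ (tendsto_const_div_sqrt hN _)
  filter_upwards [hp', hD, hN.eventually_gt_atTop 0,
    (tendsto_const_div_sqrt hN D).eventually (ge_mem_nhds one_pos)] with a hpa hDa hpos hle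
  have hsN : 0 < √(N a : ℝ) := Real.sqrt_pos.2 (by exact_mod_cast hpos)
  set d := Real.log (p' a i) - Real.log (p i) with hd
  have hexp : p' a i = p i * Real.exp d := by
    rw [hd, Real.exp_sub, Real.exp_log (hpa i), Real.exp_log (hp i)]
    field_simp [(hp i).ne']
  have h1 : p' a i - p i - p i * d = p i * (Real.exp d - 1 - d) := by rw [hexp]; ring
  rw [h1, norm_mul, norm_mul, Real.norm_eq_abs, Real.norm_eq_abs, Real.norm_eq_abs,
    abs_of_pos hsN, abs_of_pos (hp i)]
  have h2 := Real.abs_exp_sub_one_sub_id_le ((hDa i).trans hle)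
  have h3 : d ^ 2 ≤ (D / √(N a)) ^ 2 := sq_le_sq' (by linarith [(abs_le.1 (hDa i)).1])
    ((le_abs_self _).trans (hDa i))
  calc √(N a : ℝ) * (p i * |Real.exp d - 1 - d|) ≤ √(N a : ℝ) * (p i * (D / √(N a)) ^ 2) := by
        gcongr
        · exact (hp i).le
        · exact h2.trans h3
    _ = p i * D ^ 2 / √(N a) := by field_simp

variable [Fintype ι]

/-- The vector of differences between observed and estimated counts, in the coordinates of the
standardized counts. -/
noncomputable def residual (N : ℕ) (p p' : ι → ℝ) (y : ι → ℕ) : EuclideanSpace ℝ ι :=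
  WithLp.toLp 2 fun i => ((y i : ℝ) - N * p' i) / (√N * √(p i))

theorem abs_count_div_sub_le {N : ℕ} (hN : 0 < N) (hp : ∀ i, 0 < p i)
    (hsum : ∑ i, p i = 1) {y : ι → ℕ} {M : ℝ} (hM : ‖standardize N p y‖ ≤ M) (i : ι) :
    |(y i : ℝ) / N - p i| ≤ M / √N := by
  have hN' : (0 : ℝ) < N := by exact_mod_cast hN
  have hsN : 0 < √(N : ℝ) := Real.sqrt_pos.2 hN'
  have hs : 0 < √(p i) := Real.sqrt_pos.2 (hp i)
  have hp1 : √(p i) ≤ 1 := by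
    rw [Real.sqrt_le_one, ← hsum]
    exact Finset.single_le_sum (fun j _ => (hp j).le) (Finset.mem_univ i)
  have h1 : |standardize N p y i| ≤ M := (PiLp.norm_apply_le (standardize N p y) i).trans hM
  have h2 : (y i : ℝ) / N - p i = standardize N p y i * √(p i) / √N := by
    change _ = ((y i : ℝ) - N * p i) / (√N * √(p i)) * √(p i) / √N
    have h3 : (N : ℝ) = √N * √N := (Real.mul_self_sqrt hN'.le).symm
    generalize √(N : ℝ) = n at *
    rw [h3]
    field_simp
  rw [h2, abs_div, abs_mul, abs_of_pos hs, abs_of_pos hsN]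
  gcongr
  calc _ ≤ M * 1 := mul_le_mul h1 hp1 hs.le ((abs_nonneg _).trans h1)
    _ = M := mul_one M

theorem exists_pos_le_half (hp : ∀ i, 0 < p i) (hsum : ∑ i, p i = 1) :
    ∃ m, 0 < m ∧ ∀ i, m ≤ p i / 2 := by
  have : Nonempty ι := by
    by_contra h
    rw [not_nonempty_iff] at h
    simp at hsum
  obtain ⟨i, hi⟩ := Finite.exists_min p
  exact ⟨p i / 2, half_pos (hp i), fun j => by linarith [hi j]⟩

theorem eventually_le_count_div (hN : Tendsto N l atTop) (hp : ∀ i, 0 < p i)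
    (hsum : ∑ i, p i = 1) {y : α → ι → ℕ} {M : ℝ}
    (hM : ∀ᶠ a in l, ‖standardize (N a) p (y a)‖ ≤ M) {m : ℝ} (hm : 0 < m)
    (hmp : ∀ i, m ≤ p i / 2) : ∀ᶠ a in l, ∀ i, m ≤ (y a i : ℝ) / N a := by
  filter_upwards [hM, hN.eventually_gt_atTop 0,
    (tendsto_const_div_sqrt hN M).eventually (ge_mem_nhds hm)] with a ha hpos hle i
  have := (abs_le.1 (abs_count_div_sub_le hpos hp hsum ha i)).1
  linarith [hmp i]

theorem eventually_count_pos (hN : Tendsto N l atTop) (hp : ∀ i, 0 < p i)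
    (hsum : ∑ i, p i = 1) {y : α → ι → ℕ} {M : ℝ}
    (hM : ∀ᶠ a in l, ‖standardize (N a) p (y a)‖ ≤ M) : ∀ᶠ a in l, ∀ i, 0 < y a i := by
  obtain ⟨m, hm, hmp⟩ := exists_pos_le_half hp hsum
  filter_upwards [eventually_le_count_div hN hp hsum hM hm hmp] with a ha i
  rw [Nat.pos_iff_ne_zero]
  intro h0
  have := ha i
  rw [h0, Nat.cast_zero, zero_div] at this
  linarith

variable {κ : Type*} [Fintype κ] {A : Matrix κ ι ℝ} {y : α → ι → ℕ} {M : ℝ}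

theorem exists_eventually_abs_log_sub_le (hp : p ∈ modelProb A) (hN : Tendsto N l atTop)
    (hy : ∀ᶠ a in l, ∑ i, y a i = N a) (hM : ∀ᶠ a in l, ‖standardize (N a) p (y a)‖ ≤ M)
    (hp' : ∀ᶠ a in l, IsMLE A (y a) (p' a)) :
    ∃ D, ∀ᶠ a in l, ∀ i, |Real.log (p' a i) - Real.log (p i)| ≤ D / √(N a) := by
  obtain ⟨m, hm, hmp⟩ := exists_pos_le_half hp.1 hp.2.1
  obtain ⟨C, hC, h⟩ := exists_abs_log_sub_log_le hp.1 hp.2.1 hm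
    fun i => (hmp i).trans (half_le_self (hp.1 i).le)
  refine ⟨C * M, ?_⟩
  filter_upwards [hM, hN.eventually_gt_atTop 0, hy, hp',
    eventually_le_count_div hN hp.1 hp.2.1 hM hm hmp] with a ha hpos hya hMLE hlow i
  have hN' : (0 : ℝ) < N a := by exact_mod_cast hpos
  have hcount : ∑ i, (y a i : ℝ) / N a = 1 := by
    rw [← Finset.sum_div, ← hya]
    push_cast
    rw [← Nat.cast_sum, hya, div_self hN'.ne']
  rw [mul_div_assoc]
  refine h (fun i => (y a i : ℝ) / N a) (p' a) _ hMLE.1.1 hMLE.1.2.1 hlow hcount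
    (abs_count_div_sub_le hpos hp.1 hp.2.1 ha) ?_ i
  simp only [div_mul_eq_mul_div, ← Finset.sum_div]
  exact div_le_div_of_nonneg_right ((isMLE_iff.1 hMLE).2 p hp) hN'.le

theorem exists_eventually_norm_residual_le (hp : ∀ i, 0 < p i) (hN : Tendsto N l atTop)
    (hM : ∀ᶠ a in l, ‖standardize (N a) p (y a)‖ ≤ M)
    (hp' : ∀ᶠ a in l, ∀ i, 0 < p' a i) {D : ℝ}
    (hD : ∀ᶠ a in l, ∀ i, |Real.log (p' a i) - Real.log (p i)| ≤ D / √(N a)) (i : ι) :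
    ∃ M', ∀ᶠ a in l, |residual (N a) p (p' a) (y a) i| ≤ M' := by
  -- `M` bounds the standardized count, `1` the linearization error, which is eventually small, and
  -- `D` the scaled log displacement.
  refine ⟨M + (1 + p i * D) / √(p i), ?_⟩
  filter_upwards [hM, hD, hN.eventually_gt_atTop 0,
    (tendsto_sqrt_mul_sub_sub hp hN hp' hD i).abs.eventually
      (ge_mem_nhds (by simp : |(0 : ℝ)| < 1))] with a hMa hDa hpos hle
  have hsN : 0 < √(N a : ℝ) := Real.sqrt_pos.2 (by exact_mod_cast hpos)
  have hs : 0 < √(p i) := Real.sqrt_pos.2 (hp i)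
  have h1 : |standardize (N a) p (y a) i| ≤ M :=
    (PiLp.norm_apply_le (standardize (N a) p (y a)) i).trans hMa
  set d := Real.log (p' a i) - Real.log (p i) with hd
  have h2 : residual (N a) p (p' a) (y a) i = standardize (N a) p (y a) i -
      (√(N a) * (p' a i - p i - p i * d) + p i * (√(N a) * d)) / √(p i) := by
    change ((y a i : ℝ) - N a * p' a i) / (√(N a) * √(p i)) =
      ((y a i : ℝ) - N a * p i) / (√(N a) * √(p i)) - _
    have h3 : (N a : ℝ) = √(N a) * √(N a) := (Real.mul_self_sqrt (Nat.cast_nonneg _)).symm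
    generalize √(N a : ℝ) = n at *
    rw [h3]
    field_simp
    ring
  have h4 : |√(N a : ℝ) * d| ≤ D := by
    rw [abs_mul, abs_of_pos hsN, ← le_div_iff₀' hsN]; exact hDa i
  rw [h2]
  refine (abs_sub _ _).trans (add_le_add h1 ?_)
  rw [abs_div, abs_of_pos hs]
  gcongr
  refine (abs_add_le _ _).trans (add_le_add hle ?_)
  rw [abs_mul, abs_of_pos (hp i)]
  exact mul_le_mul_of_nonneg_left h4 (hp i).le

/-- Against `√p` the inner product is exactly zero, as observed and fitted counts have the same
total. Against a tangent direction `θ`, the likelihood equations turn it into the bounded inner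
product with `√p · A' 1` times the ratio of `∑ p' A'θ` to `∑ p' A'1`, which tends to zero since `∑ p
A'θ = 0`. -/
theorem tendsto_inner_residual_zero (hA : IsDesignMatrix A) (hp : p ∈ modelProb A)
    (hN : Tendsto N l atTop) (hy : ∀ᶠ a in l, ∑ i, y a i = N a)
    (hp' : ∀ᶠ a in l, IsMLE A (y a) (p' a))
    (hlim : ∀ i, Tendsto (fun a => p' a i) l (𝓝 (p i)))
    (hbd : ∀ i, ∃ M', ∀ᶠ a in l, |residual (N a) p (p' a) (y a) i| ≤ M')
    {u : EuclideanSpace ℝ ι} (hu : u ∈ tangentSpan A p) :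
    Tendsto (fun a => inner ℝ (residual (N a) p (p' a) (y a)) u) l (𝓝 0) := by
  have hin : ∀ a (k : ι → ℝ), inner ℝ (residual (N a) p (p' a) (y a))
      (WithLp.toLp 2 fun i => √(p i) * k i) = (∑ i, (y a i - N a * p' a i) * k i) / √(N a) := by
    intro a k
    simp only [residual, PiLp.inner_apply, RCLike.inner_apply, conj_trivial, Finset.sum_div]
    refine Finset.sum_congr rfl fun i _ => ?_
    have hs : √(p i) ≠ 0 := (Real.sqrt_pos.2 (hp.1 i)).ne'
    rcases eq_or_ne √(N a : ℝ) 0 with h0 | h0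
    · simp [h0]
    · field_simp
  induction hu using Submodule.span_induction with
  | mem u hu =>
    rcases hu with rfl | ⟨θ, hθ, rfl⟩
    · refine tendsto_const_nhds.congr' ?_
      filter_upwards [hy, hp'] with a hya hpa
      have h1 := hin a 1
      simp only [Pi.one_apply, mul_one] at h1
      rw [sqrtVec, h1, Finset.sum_sub_distrib, ← Finset.mul_sum, hpa.1.2.1, ← Nat.cast_sum, hya]
      simp
    · have hlinear : ∀ θ : κ → ℝ, Tendsto (fun a => ∑ i, p' a i * A.transpose.mulVec θ i) l
          (𝓝 (∑ i, p i * A.transpose.mulVec θ i)) := fun θ =>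
        tendsto_finsetSum _ fun i _ => (hlim i).mul_const _
      have hPv := hA.sum_mul_transpose_mulVec_one_pos hp
      have h2 : Tendsto (fun a => (∑ i, p' a i * A.transpose.mulVec θ i) /
          ∑ i, p' a i * A.transpose.mulVec 1 i) l (𝓝 0) := by
        have := (hlinear θ).div (hlinear 1) hPv.ne'
        rwa [hθ, zero_div] at this
      have h3 : Tendsto (fun a => ∑ i, residual (N a) p (p' a) (y a) i *
          (√(p i) * A.transpose.mulVec 1 i * ((∑ i, p' a i * A.transpose.mulVec θ i) /
          ∑ i, p' a i * A.transpose.mulVec 1 i))) l (𝓝 0) := by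
        rw [← Finset.sum_const_zero (ι := ι) (s := Finset.univ)]
        refine tendsto_finsetSum _ fun i _ => ?_
        obtain ⟨M', hM'⟩ := hbd i
        exact tendsto_mul_zero_of_eventually_abs_le hM' (by simpa using h2.const_mul _)
      refine h3.congr' ?_
      filter_upwards [hp', hN.eventually_gt_atTop 0] with a hpa hpos
      have hN' : (0 : ℝ) < N a := by exact_mod_cast hpos
      have hPv' := hA.sum_mul_transpose_mulVec_one_pos hpa.1
      have h4 := hin a (A.transpose.mulVec 1)
      simp only [PiLp.inner_apply, RCLike.inner_apply, conj_trivial] at h4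
      simp only [← mul_assoc, ← Finset.sum_mul]
      have h5 : ∑ i, residual (N a) p (p' a) (y a) i * √(p i) * A.transpose.mulVec 1 i =
          (∑ i, (y a i - N a * p' a i) * A.transpose.mulVec 1 i) / √(N a) := by
        rw [← h4]
        exact Finset.sum_congr rfl fun i _ => by ring
      rw [h5, hin]
      have h6 := hpa.sum_mul_sum_eq hA θ
      simp only [sub_mul, Finset.sum_sub_distrib, mul_assoc, ← Finset.mul_sum]
      have hsN : √(N a : ℝ) ≠ 0 := (Real.sqrt_pos.2 hN').ne'
      field_simp
      linear_combination -h6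
  | zero => simpa using tendsto_const_nhds
  | add u v _ _ hu hv => simpa [inner_add_right] using hu.add hv
  | smul c u _ hu => simpa [inner_smul_right] using hu.const_mul c

/-- Pythagoras along `U`: the part of the residual in `U` tends to zero by the likelihood equations.
The part in `Uᗮ` is that of the standardized counts up to `b → 0`, because the log displacement
comes from the row space. -/
theorem tendsto_norm_sq_residual_sub (hA : IsDesignMatrix A) (hp : p ∈ modelProb A)
    (hN : Tendsto N l atTop) (hy : ∀ᶠ a in l, ∑ i, y a i = N a)
    (hM : ∀ᶠ a in l, ‖standardize (N a) p (y a)‖ ≤ M)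
    (hp' : ∀ᶠ a in l, IsMLE A (y a) (p' a)) {D : ℝ}
    (hD : ∀ᶠ a in l, ∀ i, |Real.log (p' a i) - Real.log (p i)| ≤ D / √(N a)) :
    Tendsto (fun a => ‖residual (N a) p (p' a) (y a)‖ ^ 2 -
      ‖(tangentSpan A p)ᗮ.orthogonalProjectionOnto (standardize (N a) p (y a))‖ ^ 2) l (𝓝 0) := by
  classical
  have hpos' : ∀ᶠ a in l, ∀ i, 0 < p' a i := hp'.mono fun a ha => ha.1.1
  have hlim := tendsto_of_abs_log_sub_le hp.1 hN hpos' hD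
  have hbd := exists_eventually_norm_residual_le hp.1 hN hM hpos' hD
  have hPv := hA.sum_mul_transpose_mulVec_one_pos hp
  set U := tangentSpan A p with hU
  set v : ι → ℝ := A.transpose.mulVec 1 with hv
  let d : α → ι → ℝ := fun a i => Real.log (p' a i) - Real.log (p i)
  let r : α → ι → ℝ := fun a i => √(N a) * (p' a i - p i - p i * d a i)
  -- The log displacement is tangent only to first order; this multiple of `A' 1` restores tangency
  -- exactly, since `∑ p (√N d) = -∑ r`.
  let c : α → ℝ := fun a => -(∑ i, r a i) / ∑ i, p i * v i
  let b : α → EuclideanSpace ℝ ι := fun a =>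
    WithLp.toLp 2 fun i => r a i / √(p i) + √(p i) * (c a * v i)
  have hr : ∀ i, Tendsto (fun a => r a i) l (𝓝 0) := tendsto_sqrt_mul_sub_sub hp.1 hN hpos' hD
  have hc : Tendsto c l (𝓝 0) := by
    have := ((tendsto_finsetSum Finset.univ fun i _ => hr i).neg).div_const (∑ i, p i * v i)
    simpa using this
  have normsq : ∀ f : α → EuclideanSpace ℝ ι, (∀ i, Tendsto (fun a => f a i) l (𝓝 0)) →
      Tendsto (fun a => ‖f a‖ ^ 2) l (𝓝 0) := fun f hf => by
    simp only [EuclideanSpace.norm_sq_eq, Real.norm_eq_abs, sq_abs]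
    have := tendsto_finsetSum Finset.univ fun i _ => (hf i).pow 2
    simpa using this
  have hb : Tendsto (fun a => ‖b a‖) l (𝓝 0) := by
    have h1 := normsq b fun i => by
      change Tendsto (fun a => r a i / √(p i) + √(p i) * (c a * v i)) l (𝓝 0)
      simpa using ((hr i).div_const (√(p i))).add ((hc.mul_const (v i)).const_mul (√(p i)))
    have := (Real.continuous_sqrt.tendsto _).comp h1
    simpa [Function.comp_def] using this
  have hPU : Tendsto (fun a => ‖U.orthogonalProjectionOnto (residual (N a) p (p' a) (y a))‖ ^ 2) l
      (𝓝 0) := by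
    -- The coordinates of the projection are inner products of the residual with the projected basis
    -- vectors, which are fixed elements of `U`.
    refine normsq (fun a => (U.orthogonalProjectionOnto (residual (N a) p (p' a) (y a)) :
      EuclideanSpace ℝ ι)) fun i => ?_
    refine (tendsto_inner_residual_zero hA hp hN hy hp' hlim hbd
      (U.orthogonalProjectionOnto (EuclideanSpace.single i 1)).2).congr fun a => ?_
    rw [← U.inner_orthogonalProjectionOnto_eq_of_mem_right,
      U.inner_orthogonalProjectionOnto_eq_of_mem_left, EuclideanSpace.inner_single_right]
    simp
  have hPV : ∀ᶠ a in l, Uᗮ.orthogonalProjectionOnto (residual (N a) p (p' a) (y a)) =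
      Uᗮ.orthogonalProjectionOnto (standardize (N a) p (y a)) -
        Uᗮ.orthogonalProjectionOnto (b a) := by
    filter_upwards [hp', hN.eventually_gt_atTop 0] with a hpa hpos
    rw [← map_sub, ← sub_eq_zero, ← map_sub]
    apply Submodule.orthogonalProjectionOnto_orthogonal_apply_eq_zero
    obtain ⟨θ₀, hθ₀⟩ := hp.2.2
    obtain ⟨θ', hθ'⟩ := hpa.1.2.2
    have hdir : ∀ i, A.transpose.mulVec (√(N a) • (θ₀ - θ') + c a • 1) i =
        -(√(N a) * d a i) + c a * v i := fun i => by
      rw [Matrix.mulVec_add, Matrix.mulVec_smul, Matrix.mulVec_smul, Matrix.mulVec_sub, ← hθ₀,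
        ← hθ']
      simp only [Pi.add_apply, Pi.smul_apply, Pi.sub_apply, smul_eq_mul, d, v]
      ring
    have htan : ∑ i, p i * A.transpose.mulVec (√(N a) • (θ₀ - θ') + c a • 1) i = 0 := by
      have h1 : ∀ i, p i * A.transpose.mulVec (√(N a) • (θ₀ - θ') + c a • 1) i =
          r a i - √(N a) * (p' a i - p i) + c a * (p i * v i) := fun i => by
        rw [hdir]; simp only [r]; ring
      simp only [h1, Finset.sum_add_distrib, Finset.sum_sub_distrib, ← Finset.mul_sum,
        hp.2.1, hpa.1.2.1]
      simp only [c]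
      rw [div_mul_cancel₀ _ hPv.ne']
      ring
    convert toLp_mem_tangentSpan htan using 1
    ext i
    refine Eq.trans ?_ (congrArg (√(p i) * ·) (hdir i).symm)
    change ((y a i : ℝ) - N a * p' a i) / (√(N a) * √(p i)) -
      (((y a i : ℝ) - N a * p i) / (√(N a) * √(p i)) -
        (r a i / √(p i) + √(p i) * (c a * v i))) = _
    simp only [r]
    have hs : √(p i) ≠ 0 := (Real.sqrt_pos.2 (hp.1 i)).ne'
    have hsN : √(N a : ℝ) ≠ 0 := (Real.sqrt_pos.2 (by exact_mod_cast hpos)).ne'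
    have h3 : (N a : ℝ) = √(N a) ^ 2 := (Real.sq_sqrt (Nat.cast_nonneg _)).symm
    have h4 : p i = √(p i) ^ 2 := (Real.sq_sqrt (hp.1 i).le).symm
    generalize d a i = δ
    generalize √(N a : ℝ) = n at *
    generalize √(p i) = s at *
    rw [h3, h4]
    field_simp
    ring
  set w : α → Uᗮ := fun a => Uᗮ.orthogonalProjectionOnto (standardize (N a) p (y a)) with hw
  have hPb : Tendsto (fun a => ‖Uᗮ.orthogonalProjectionOnto (b a)‖) l (𝓝 0) :=
    squeeze_zero (fun _ => norm_nonneg _)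
      (fun a => Submodule.norm_orthogonalProjectionOnto_apply_le _ _) hb
  have hcross : Tendsto (fun a => inner ℝ (w a) (Uᗮ.orthogonalProjectionOnto (b a))) l (𝓝 0) := by
    refine squeeze_zero_norm' (a := fun a => M * ‖Uᗮ.orthogonalProjectionOnto (b a)‖) ?_
      (by simpa using hPb.const_mul M)
    filter_upwards [hM] with a ha
    refine (norm_inner_le_norm _ _).trans (mul_le_mul_of_nonneg_right ?_ (norm_nonneg _))
    exact (Submodule.norm_orthogonalProjectionOnto_apply_le _ _).trans ha
  have htotal := (hPU.sub (hcross.const_mul 2)).add (hPb.pow 2)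
  simp only [mul_zero, sub_zero, add_zero, ne_eq, OfNat.ofNat_ne_zero, not_false_eq_true,
    zero_pow] at htotal
  refine htotal.congr' ?_
  filter_upwards [hPV] with a ha
  rw [Submodule.norm_sq_eq_add_norm_sq_projection (residual (N a) p (p' a) (y a)) U, ha,
    norm_sub_sq_real]
  ring

end Asymptotics

/-! ### Comparison of the Pearson and Bregman statistics with the residual. -/

section Statistics

/-- With `R` the error of the second-order expansion of `log (1 + x)`, the left side is `|2 (1 + x)
R - x ^ 3|`; the bounds `3 / 2` on `|1 + x|` and `2 |x| ^ 3` on `|R|` would even give the constant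
7. -/
theorem abs_entropy_remainder_le {x : ℝ} (hx : |x| ≤ 1 / 2) :
    |2 * ((1 + x) * Real.log (1 + x) - x) - x ^ 2| ≤ 8 * |x| ^ 3 := by
  have h1 := Real.abs_log_sub_add_sum_range_le (x := -x) (by rw [abs_neg]; linarith) 2
  simp only [Finset.sum_range_succ, Finset.sum_range_zero, abs_neg, sub_neg_eq_add] at h1
  norm_num at h1
  have h2 : |x| ^ 3 / (1 - |x|) ≤ 2 * |x| ^ 3 := by
    rw [div_le_iff₀ (by linarith)]
    have : 0 ≤ |x| ^ 3 := by positivity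
    nlinarith
  set R := -x + x ^ 2 / 2 + Real.log (1 + x) with hR
  have h3 : 2 * ((1 + x) * Real.log (1 + x) - x) - x ^ 2 = 2 * (1 + x) * R - x ^ 3 := by
    rw [hR]; ring
  rw [h3]
  refine (abs_sub _ _).trans ?_
  rw [abs_mul, abs_mul, abs_two, abs_pow]
  have h4 : |1 + x| ≤ 3 / 2 := (abs_add_le _ _).trans (by rw [abs_one]; linarith)
  have h5 : |R| ≤ 2 * |x| ^ 3 := h1.trans h2
  have h6 : |1 + x| * |R| ≤ 3 / 2 * (2 * |x| ^ 3) := by gcongr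
  have h7 : 0 ≤ |x| ^ 3 := by positivity
  linarith

theorem abs_bregman_term_sub_le {u v : ℝ} (hv : 0 < v) (h : |(u - v) / v| ≤ 1 / 2) :
    |2 * (u * Real.log (u / v) - (u - v)) - (u - v) ^ 2 / v| ≤
      8 * ((u - v) ^ 2 / v) * |(u - v) / v| := by
  set x := (u - v) / v with hx
  have hu : u = v * (1 + x) := by rw [hx]; field_simp; ring
  have h1 : u / v = 1 + x := by rw [hu]; field_simp
  have h2 : u - v = v * x := by rw [hu]; ring
  have h3 : (v * x) ^ 2 / v = v * x ^ 2 := by field_simp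
  rw [h1, h2, h3, hu]
  have h4 : 2 * (v * (1 + x) * Real.log (1 + x) - v * x) - v * x ^ 2 =
      v * (2 * ((1 + x) * Real.log (1 + x) - x) - x ^ 2) := by ring
  rw [h4, abs_mul, abs_of_pos hv]
  calc _ ≤ v * (8 * |x| ^ 3) := mul_le_mul_of_nonneg_left (abs_entropy_remainder_le h) hv.le
    _ = 8 * (v * x ^ 2) * |x| := by rw [← sq_abs x]; ring

variable {ι : Type*} {α : Type*} {l : Filter α} {N : α → ℕ} {p : ι → ℝ}
  {p' : α → ι → ℝ} {y : α → ι → ℕ}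

theorem sq_sub_div_eq_residual {N : ℕ} (hN : 0 < N) {p p' : ι → ℝ} (hp : ∀ i, 0 < p i)
    (y : ι → ℕ) (i : ι) :
    ((y i : ℝ) - N * p' i) ^ 2 / (N * p' i) = residual N p p' y i ^ 2 * (p i / p' i) := by
  change _ = (((y i : ℝ) - N * p' i) / (√N * √(p i))) ^ 2 * _
  have hN' : (0 : ℝ) < N := by exact_mod_cast hN
  rw [div_pow, mul_pow, Real.sq_sqrt hN'.le, Real.sq_sqrt (hp i).le]
  field_simp [(hp i).ne']

theorem tendsto_residual_sq_mul
    (hbd : ∀ i, ∃ M', ∀ᶠ a in l, |residual (N a) p (p' a) (y a) i| ≤ M') (i : ι) {g : α → ℝ}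
    (hg : Tendsto g l (𝓝 0)) :
    Tendsto (fun a => residual (N a) p (p' a) (y a) i ^ 2 * g a) l (𝓝 0) := by
  obtain ⟨M', hM'⟩ := hbd i
  refine tendsto_mul_zero_of_eventually_abs_le (M := M' ^ 2) (hM'.mono fun a ha => ?_) hg
  rw [abs_pow]
  exact pow_le_pow_left₀ (abs_nonneg _) ha 2

variable [Fintype ι]

theorem tendsto_pearson_sub_norm_sq_residual (hp : ∀ i, 0 < p i) (hN : Tendsto N l atTop)
    (hlim : ∀ i, Tendsto (fun a => p' a i) l (𝓝 (p i)))
    (hbd : ∀ i, ∃ M', ∀ᶠ a in l, |residual (N a) p (p' a) (y a) i| ≤ M') :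
    Tendsto (fun a => pearson (fun i => (y a i : ℝ)) (fun i => (N a : ℝ) * p' a i) -
      ‖residual (N a) p (p' a) (y a)‖ ^ 2) l (𝓝 0) := by
  have h1 : ∀ i, Tendsto (fun a => p i / p' a i - 1) l (𝓝 0) := fun i => by
    have := ((tendsto_const_nhds (x := p i)).div (hlim i) (hp i).ne').sub_const 1
    rwa [div_self (hp i).ne', sub_self] at this
  have h2 := tendsto_finsetSum Finset.univ fun i _ =>
    tendsto_residual_sq_mul hbd i (h1 i)
  rw [Finset.sum_const_zero] at h2
  refine h2.congr' ?_
  filter_upwards [hN.eventually_gt_atTop 0] with a hpos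
  simp only [pearson, EuclideanSpace.norm_sq_eq, Real.norm_eq_abs, sq_abs,
    sq_sub_div_eq_residual hpos hp, ← Finset.sum_sub_distrib]
  exact Finset.sum_congr rfl fun i _ => by ring

/-- Termwise, the difference is at most eight times the bounded Pearson term times the relative
deviation `x`, which is the residual times a factor of order `1 / √N`. -/
theorem tendsto_bregman_sub_pearson (hp : ∀ i, 0 < p i) (hN : Tendsto N l atTop)
    (hp' : ∀ᶠ a in l, ∀ i, 0 < p' a i)
    (hlim : ∀ i, Tendsto (fun a => p' a i) l (𝓝 (p i)))
    (hbd : ∀ i, ∃ M', ∀ᶠ a in l, |residual (N a) p (p' a) (y a) i| ≤ M') :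
    Tendsto (fun a => bregman (fun i => (y a i : ℝ)) (fun i => (N a : ℝ) * p' a i) -
      pearson (fun i => (y a i : ℝ)) (fun i => (N a : ℝ) * p' a i)) l (𝓝 0) := by
  let x : α → ι → ℝ := fun a i => ((y a i : ℝ) - N a * p' a i) / (N a * p' a i)
  have hratio : ∀ i, Tendsto (fun a => p i / p' a i) l (𝓝 1) := fun i => by
    have := (tendsto_const_nhds (x := p i)).div (hlim i) (hp i).ne'
    rwa [div_self (hp i).ne'] at this
  have hx : ∀ i, Tendsto (fun a => x a i) l (𝓝 0) := fun i => by
    obtain ⟨M', hM'⟩ := hbd i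
    have h1 : Tendsto (fun a => √(p i) / p' a i * (1 / √(N a : ℝ))) l (𝓝 0) := by
      simpa using ((tendsto_const_nhds (x := √(p i))).div (hlim i) (hp i).ne').mul
        (tendsto_const_div_sqrt hN 1)
    refine (tendsto_mul_zero_of_eventually_abs_le hM' h1).congr' ?_
    filter_upwards [hN.eventually_gt_atTop 0] with a hpos
    change ((y a i : ℝ) - N a * p' a i) / (√(N a) * √(p i)) * _ =
      ((y a i : ℝ) - N a * p' a i) / (N a * p' a i)
    have hsN : √(N a : ℝ) ≠ 0 := (Real.sqrt_pos.2 (by exact_mod_cast hpos)).ne'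
    have hs : √(p i) ≠ 0 := (Real.sqrt_pos.2 (hp i)).ne'
    have h3 : (N a : ℝ) = √(N a) * √(N a) := (Real.mul_self_sqrt (Nat.cast_nonneg _)).symm
    generalize (y a i : ℝ) - N a * p' a i = e
    generalize √(N a : ℝ) = n at *
    rw [h3]
    field_simp
  have hbound : Tendsto (fun a => ∑ i, residual (N a) p (p' a) (y a) i ^ 2 *
      (8 * (p i / p' a i) * |x a i|)) l (𝓝 0) := by
    rw [← Finset.sum_const_zero (ι := ι) (s := Finset.univ)]
    refine tendsto_finsetSum _ fun i _ => tendsto_residual_sq_mul hbd i ?_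
    simpa using ((hratio i).const_mul 8).mul (hx i).abs
  refine squeeze_zero_norm' ?_ hbound
  have hsmall : ∀ᶠ a in l, ∀ i, |x a i| ≤ 1 / 2 := eventually_all.2 fun i =>
    (hx i).abs.eventually (ge_mem_nhds (by norm_num))
  filter_upwards [hN.eventually_gt_atTop 0, hp', hsmall] with a hpos hpa hxa
  have hN' : (0 : ℝ) < N a := by exact_mod_cast hpos
  rw [bregman, pearson, Finset.mul_sum, ← Finset.sum_sub_distrib]
  refine (norm_sum_le _ _).trans (Finset.sum_le_sum fun i _ => ?_)
  refine (abs_bregman_term_sub_le (mul_pos hN' (hpa i)) (hxa i)).trans (le_of_eq ?_)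
  rw [sq_sub_div_eq_residual hpos hp]
  ring

end Statistics

/-! ### From deterministic limits on balls to weak limits. -/

section WeakLimit

variable {κ ι : Type*} [Fintype κ] [Fintype ι] {A : Matrix κ ι ℝ} {p : ι → ℝ}

theorem tendsto_statistics_sub {α : Type*} {l : Filter α} {N : α → ℕ} {p' : α → ι → ℝ}
    {y : α → ι → ℕ} {M : ℝ} (hA : IsDesignMatrix A) (hp : p ∈ modelProb A)
    (hN : Tendsto N l atTop) (hy : ∀ᶠ a in l, ∑ i, y a i = N a)
    (hM : ∀ᶠ a in l, ‖standardize (N a) p (y a)‖ ≤ M)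
    (hp' : ∀ᶠ a in l, IsMLE A (y a) (p' a)) :
    Tendsto (fun a => pearson (fun i => (y a i : ℝ)) (fun i => (N a : ℝ) * p' a i) -
      ‖(tangentSpan A p)ᗮ.orthogonalProjectionOnto (standardize (N a) p (y a))‖ ^ 2) l (𝓝 0) ∧
    Tendsto (fun a => bregman (fun i => (y a i : ℝ)) (fun i => (N a : ℝ) * p' a i) -
      ‖(tangentSpan A p)ᗮ.orthogonalProjectionOnto (standardize (N a) p (y a))‖ ^ 2) l (𝓝 0) := by
  obtain ⟨D, hD⟩ := exists_eventually_abs_log_sub_le hp hN hy hM hp'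
  have hpos' : ∀ᶠ a in l, ∀ i, 0 < p' a i := hp'.mono fun a ha => ha.1.1
  have hlim := tendsto_of_abs_log_sub_le hp.1 hN hpos' hD
  have hbd := exists_eventually_norm_residual_le hp.1 hN hM hpos' hD
  have h1 := tendsto_norm_sq_residual_sub hA hp hN hy hM hp' hD
  have h2 := tendsto_pearson_sub_norm_sq_residual hp.1 hN hlim hbd
  have h3 := tendsto_bregman_sub_pearson hp.1 hN hpos' hlim hbd
  have h4 := h2.add h1
  have h5 := h3.add h4
  rw [add_zero] at h4
  rw [add_zero, add_zero] at h5
  exact ⟨h4.congr fun a => by ring, h5.congr fun a => by ring⟩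

/-- Tightness fixes `M` from `ε` before `N` is chosen, so a property that holds eventually on each
ball fails with probability at most `ε`. -/
theorem tendsto_multinomial_not_zero [DecidableEq ι] (hp : ∀ i, 0 < p i) (hsum : ∑ i, p i = 1)
    {Q : ℕ → (ι → ℕ) → Prop}
    (h : ∀ M, ∀ᶠ N in atTop, ∀ y, ∑ i, y i = N → ‖standardize N p y‖ ≤ M → Q N y) :
    Tendsto (fun N => multinomial N p {y | ¬ Q N y}) atTop (𝓝 0) := by
  rw [ENNReal.tendsto_nhds_zero]
  intro ε hε
  obtain ⟨M, hM⟩ := exists_norm_bound_standardize hp hsum hε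
  filter_upwards [h M] with N hN
  calc multinomial N p {y | ¬ Q N y}
      ≤ multinomial N p ({y | ∑ i, y i ≠ N} ∪ {y | M < ‖standardize N p y‖}) := by
        refine measure_mono fun y hy => ?_
        by_contra hcon
        rw [Set.mem_union, not_or] at hcon
        exact hy (hN y (not_not.1 hcon.1) (not_lt.1 hcon.2))
    _ ≤ 0 + ε := (measure_union_le _ _).trans (add_le_add (multinomial_sum_ne N p).le (hM N))
    _ = ε := zero_add ε

theorem eventually_mle_and_statistics (hA : IsDesignMatrix A) (hp : p ∈ modelProb A)
    {phat : (ι → ℕ) → ι → ℝ} (hphat : ∀ y ∈ mleExists A, IsMLE A y (phat y)) (M : ℝ) {ε : ℝ}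
    (hε : 0 < ε) :
    ∀ᶠ N in atTop, ∀ y : ι → ℕ, ∑ i, y i = N → ‖standardize N p y‖ ≤ M →
      y ∈ mleExists A ∧
      |pearson (fun i => (y i : ℝ)) (fun i => (N : ℝ) * phat y i) -
        ‖(tangentSpan A p)ᗮ.orthogonalProjectionOnto (standardize N p y)‖ ^ 2| < ε ∧
      |bregman (fun i => (y i : ℝ)) (fun i => (N : ℝ) * phat y i) -
        ‖(tangentSpan A p)ᗮ.orthogonalProjectionOnto (standardize N p y)‖ ^ 2| < ε := by
  -- A limit along the filter of pairs `(N, y)` with `N → ∞`, restricted to `S`, is exactly a limit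
  -- uniform in `y` over the ball.
  let S : Set (ℕ × (ι → ℕ)) := {a | ∑ i, a.2 i = a.1 ∧ ‖standardize a.1 p a.2‖ ≤ M}
  obtain ⟨l, hl⟩ : ∃ l : Filter (ℕ × (ι → ℕ)), l = comap Prod.fst atTop ⊓ 𝓟 S := ⟨_, rfl⟩
  have hN : Tendsto (fun a : ℕ × (ι → ℕ) => a.1) l atTop :=
    hl ▸ tendsto_comap.mono_left inf_le_left
  have hS : ∀ᶠ a in l, a ∈ S := hl ▸ mem_inf_of_right (mem_principal_self S)
  have hsum : ∀ᶠ a in l, ∑ i, a.2 i = a.1 := hS.mono fun a ha => ha.1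
  have hnorm : ∀ᶠ a in l, ‖standardize a.1 p a.2‖ ≤ M :=
    hS.mono fun a ha => ha.2
  have hpos : ∀ᶠ a in l, ∀ i, 0 < a.2 i :=
    eventually_count_pos hN hp.1 hp.2.1 hnorm
  have hE : ∀ᶠ a in l, a.2 ∈ mleExists A :=
    hpos.mono fun a ha => mem_mleExists_of_pos hp ha
  have hMLE : ∀ᶠ a in l, IsMLE A a.2 (phat a.2) :=
    hE.mono fun a ha => hphat _ ha
  obtain ⟨h1, h2⟩ := tendsto_statistics_sub (α := ℕ × (ι → ℕ)) (N := fun a => a.1)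
    (y := fun a => a.2) (p' := fun a => phat a.2) hA hp hN hsum hnorm hMLE
  have h3 := ((tendsto_zero_iff_abs_tendsto_zero _).1 h1).eventually_lt_const hε
  have h4 := ((tendsto_zero_iff_abs_tendsto_zero _).1 h2).eventually_lt_const hε
  have h5 := hE.and (h3.and h4)
  rw [hl, eventually_inf_principal, eventually_comap] at h5
  filter_upwards [h5] with N hN y hy hyM
  exact hN (N, y) rfl ⟨hy, hyM⟩

theorem tendsto_integral_statistic [DecidableEq ι] (hA : IsDesignMatrix A) (hp : p ∈ modelProb A)
    {Z : ℕ → (ι → ℕ) → ℝ}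
    (hZ : ∀ ε > 0, ∀ M, ∀ᶠ N in atTop, ∀ y : ι → ℕ, ∑ i, y i = N → ‖standardize N p y‖ ≤ M →
      |Z N y - ‖(tangentSpan A p)ᗮ.orthogonalProjectionOnto (standardize N p y)‖ ^ 2| < ε)
    (f : ℝ →ᵇ ℝ) :
    Tendsto (fun N => ∫ y, f (Z N y) ∂multinomial N p) atTop
      (𝓝 (∫ x, f x ∂chiSquared (Module.finrank ℝ (LinearMap.ker A.mulVecLin)))) := by
  have hprob N := isProbabilityMeasure_multinomial N p (fun i => (hp.1 i).le) hp.2.1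
  refine tendsto_integral_of_tendsto_measure_sub (fun N => multinomial N p)
    (fun N => Measurable.of_discrete) (fun N => Measurable.of_discrete) _
    (tendsto_integral_norm_sq_projection hp.1 hp.2.1 (tangentSpan A p)ᗮ (fun x hx =>
      (Submodule.mem_orthogonal _ _).1 hx _ sqrtVec_mem_tangentSpan)
      (finrank_orthogonal_tangentSpan hA hp)) (fun ε hε => ?_) f
  refine (tendsto_multinomial_not_zero hp.1 hp.2.1 (hZ ε hε)).congr fun N => ?_
  simp only [not_lt]

end WeakLimit

end RelationalModel

/-! ### The main theorem. -/

theorem mainTheorem4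
    {κ ι : Type*} [Fintype κ] [Fintype ι] [DecidableEq ι]
    (A : Matrix κ ι ℝ) (hA : RelationalModel.IsDesignMatrix A)
    (p₀ : ι → ℝ) (hp₀ : p₀ ∈ RelationalModel.modelProb A)
    {Ω : ℕ → Type*} [∀ N, MeasurableSpace (Ω N)]
    (P : ∀ N, Measure (Ω N)) [∀ N, IsProbabilityMeasure (P N)]
    (Y : ∀ N, Ω N → ι → ℕ) (hY_meas : ∀ N, Measurable (Y N))
    (hY : ∀ N, HasLaw (Y N) (RelationalModel.multinomial N p₀) (P N))
    (phat : (ι → ℕ) → ι → ℝ)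
    (hphat : ∀ y ∈ RelationalModel.mleExists A, RelationalModel.IsMLE A y (phat y))
    (K : ℕ) (hK : K = Module.finrank ℝ (LinearMap.ker A.mulVecLin)) :
    (∀ᶠ N in atTop, 0 < P N (Y N ⁻¹' RelationalModel.mleExists A)) ∧
    RelationalModel.ConvergesInLaw
      (fun N => (P N)[|Y N ⁻¹' RelationalModel.mleExists A])
      (fun N ω => RelationalModel.pearson (fun i => (Y N ω i : ℝ))
        (fun i => (N : ℝ) * phat (Y N ω) i))
      (RelationalModel.chiSquared K) ∧
    RelationalModel.ConvergesInLaw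
      (fun N => (P N)[|Y N ⁻¹' RelationalModel.mleExists A])
      (fun N ω => RelationalModel.bregman (fun i => (Y N ω i : ℝ))
        (fun i => (N : ℝ) * phat (Y N ω) i))
      (RelationalModel.chiSquared K) ∧
    RelationalModel.ConvergesInLaw P
      (fun N ω => RelationalModel.pearson (fun i => (Y N ω i : ℝ))
        (fun i => (N : ℝ) * RelationalModel.augmentedMLE A phat (Y N ω) i))
      (RelationalModel.chiSquared K) ∧
    RelationalModel.ConvergesInLaw P
      (fun N ω => RelationalModel.bregman (fun i => (Y N ω i : ℝ))
        (fun i => (N : ℝ) * RelationalModel.augmentedMLE A phat (Y N ω) i))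
      (RelationalModel.chiSquared K) := by
  open RelationalModel in
  open scoped BoundedContinuousFunction in
  subst hK
  have haug : ∀ y ∈ mleExists A, augmentedMLE A phat y = phat y := fun y hy => if_pos hy
  have hstat := fun M (ε : ℝ) (hε : 0 < ε) => eventually_mle_and_statistics hA hp₀ hphat M hε
  have hPE : Tendsto (fun N => P N (Y N ⁻¹' mleExists A)ᶜ) atTop (𝓝 0) := by
    refine (tendsto_multinomial_not_zero (Q := fun _ y => y ∈ mleExists A) hp₀.1 hp₀.2.1
      fun M => (hstat M 1 one_pos).mono fun N hN y h1 h2 => (hN y h1 h2).1).congr fun N => ?_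
    rw [← (hY N).map_eq, Measure.map_apply (hY_meas N) MeasurableSet.of_discrete]
    rfl
  have hE N : MeasurableSet (Y N ⁻¹' mleExists A) := hY_meas N MeasurableSet.of_discrete
  have hlim : ∀ Z : ℕ → (ι → ℕ) → ℝ, (∀ ε > 0, ∀ M, ∀ᶠ N in atTop, ∀ y : ι → ℕ, ∑ i, y i = N →
      ‖standardize N p₀ y‖ ≤ M →
        |Z N y - ‖(tangentSpan A p₀)ᗮ.orthogonalProjectionOnto (standardize N p₀ y)‖ ^ 2| < ε) →
      ∀ f : ℝ →ᵇ ℝ, Tendsto (fun N => ∫ ω, f (Z N (Y N ω)) ∂P N) atTop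
        (𝓝 (∫ x, f x ∂chiSquared (Module.finrank ℝ (LinearMap.ker A.mulVecLin)))) := by
    intro Z hZ f
    refine (tendsto_integral_statistic hA hp₀ hZ f).congr fun N => ?_
    exact ((hY N).integral_comp (f := fun y => f (Z N y))
      Measurable.of_discrete.aestronglyMeasurable).symm
  have hmeas : ∀ Z : ℕ → (ι → ℕ) → ℝ, ∀ N, Measurable fun ω => Z N (Y N ω) := fun Z N =>
    Measurable.of_discrete.comp (hY_meas N)
  have hcond : ∀ Z : ℕ → (ι → ℕ) → ℝ, (∀ ε > 0, ∀ M, ∀ᶠ N in atTop, ∀ y : ι → ℕ, ∑ i, y i = N →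
      ‖standardize N p₀ y‖ ≤ M →
        |Z N y - ‖(tangentSpan A p₀)ᗮ.orthogonalProjectionOnto (standardize N p₀ y)‖ ^ 2| < ε) →
      ConvergesInLaw (fun N => (P N)[|Y N ⁻¹' mleExists A]) (fun N ω => Z N (Y N ω))
        (chiSquared (Module.finrank ℝ (LinearMap.ker A.mulVecLin))) := by
    intro Z hZ
    refine (convergesInLaw_iff _ (hmeas Z) _).2 fun f => ?_
    exact tendsto_integral_cond P (C := ‖f‖) (fun N => f.continuous.measurable.comp (hmeas Z N))
      (fun N ω => f.norm_coe_le_norm _) hE hPE (hlim Z hZ f)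
  refine ⟨?_, ?_, ?_, ?_, ?_⟩
  -- The complement eventually has probability below one.
  · filter_upwards [hPE.eventually (gt_mem_nhds zero_lt_one)] with N hN
    rw [pos_iff_ne_zero]
    intro h0
    rw [prob_compl_eq_one_sub (hE N), h0, tsub_zero] at hN
    exact lt_irrefl _ hN
  · exact hcond (fun N y => pearson (fun i => (y i : ℝ)) fun i => (N : ℝ) * phat y i)
      fun ε hε M => (hstat M ε hε).mono fun N hN y h1 h2 => (hN y h1 h2).2.1
  · exact hcond (fun N y => bregman (fun i => (y i : ℝ)) fun i => (N : ℝ) * phat y i)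
      fun ε hε M => (hstat M ε hε).mono fun N hN y h1 h2 => (hN y h1 h2).2.2
  -- On each ball the MLE eventually exists and the augmentation is inactive, so its value elsewhere
  -- does not affect the limit.
  · let Z : ℕ → (ι → ℕ) → ℝ := fun N y =>
      pearson (fun i => (y i : ℝ)) fun i => (N : ℝ) * augmentedMLE A phat y i
    refine (convergesInLaw_iff _ (hmeas Z) _).2
      (hlim Z fun ε hε M => (hstat M ε hε).mono fun N hN y h1 h2 => ?_)
    obtain ⟨h3, h4, -⟩ := hN y h1 h2
    simpa only [Z, haug y h3] using h4
  · let Z : ℕ → (ι → ℕ) → ℝ := fun N y =>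
      bregman (fun i => (y i : ℝ)) fun i => (N : ℝ) * augmentedMLE A phat y i
    refine (convergesInLaw_iff _ (hmeas Z) _).2
      (hlim Z fun ε hε M => (hstat M ε hε).mono fun N hN y h1 h2 => ?_)
    obtain ⟨h3, -, h4⟩ := hN y h1 h2
    simpa only [Z, haug y h3] using h4
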